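/- Let $\sigma>0$ and $\alpha\in(0,\infty)$. For $N\ge 1$ let $S$ be a discrete bridge from $(0,0)$ to $(2N,0)$, that is $S(0)=S(2N)=0$ and $S(k)-S(k-1)\in\{-1,+1\}$ for $1\le k\le 2N$, extended to $[0,2N]$ by linear interpolation. Let $\mu_N$ be the probability measure on discrete bridges $$\mu_N(S)=\frac1{Z_N}\Big(\frac{p_N}{1-p_N}\Big)^{\frac12 A(S)},\qquad A(S)=\sum_{k=1}^{2N}S(k),\qquad \frac{p_N}{1-p_N}=\exp\Big(\frac{4\sigma}{(2N)^\alpha}\Big),$$ where $Z_N$ is the normalising constant. Let $L(h)=\log\cosh h$ and $h_i^N=\frac{2\sigma}{(2N)^\alpha}\big(N-i+\frac12\big)$ for $1\le i\le 2N$. For $0\le k\le 2N$ set $x_k=k/(2N)$ if $\alpha\ge1$ and $x_k=(k-N)/(2N)^\alpha$ if $\alpha<1$, and let $\Sigma^N_\alpha$ be the function that takes the value $\Sigma_\alpha^N(x_k)=\sum_{i=1}^kL'(h_i^N)$ at $x_k$ and is linear between consecutive $x_k$'s. Define $$u^N(x)=\frac{S(2Nx)-\Sigma^N_\alpha(x)}{\sqrt{2N}},\quad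 x\in[0,1],\qquad\text{if }\alpha\ge1,$$ $$u^N(x)=\frac{S(N+x(2N)^\alpha)-\Sigma^N_\alpha(x)}{(2N)^{\alpha/2}},\quad |x|\le\frac{N}{(2N)^\alpha},\qquad\text{if }\alpha<1,$$ where in the second case $u^N$ vanishes at both ends of its interval of definition and is extended by $0$ to $\mathbb R$. For an interval $J\subset\mathbb R$ let $$q_\alpha(J)=\int_J w_\alpha(u)\,du,\qquad w_\alpha(u)=\begin{cases}1&\text{if }\alpha>1,\\ L''(\sigma(1-2u))&\text{if }\alpha=1,\\ L''(2\sigma u)&\text{if }\alpha<1.\end{cases}$$ **Theorem.** Under $\mu_N$, as $N\to\infty$, $u^N$ converges in distribution to a process $B_\alpha$, in $\mathcal C([0,1],\mathbb R)$ with the uniform topology if $\alpha\ge1$, and in $\mathcal C(\mathbb R,\mathbb R)$ with the topology of uniform convergence on compact sets if $\alpha<1$. Here, $b$ being a Brownian bridge on $[0,1]$ (the continuous centred Gaussian process with covariance $s(1-t)$ for $s\le t$, which exists): 1. if $\alpha>1$, then $B_\alpha=b$; 2. if $\alpha=1$, then $B_\alpha(x)=\sqrt{q_\alpha([0,1])}\;b(\tau(x))$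 for $x\in[0,1]$, where $\tau(x)=q_\alpha([0,x])/q_\alpha([0,1])$ is an increasing homeomorphism of $[0,1]$ onto itself; 3. if $\alpha<1$, then $B_\alpha(x)=\sqrt{q_\alpha(\mathbb R)}\;b(\tau(x))$ for $x\in\mathbb R$, where $\tau(x)=q_\alpha((-\infty,x])/q_\alpha(\mathbb R)$ is an increasing homeomorphism of $\mathbb R$ onto $(0,1)$. Moreover, for $x\le y$ in $[0,1]$ (resp. in $\mathbb R$), $\mathbb E[B_\alpha(x)B_\alpha(y)]$ equals $q_\alpha([0,x])\,q_\alpha([y,1])/q_\alpha([0,1])$ if $\alpha\ge1$, and $q_\alpha((-\infty,x])\,q_\alpha([y,\infty))/q_\alpha(\mathbb R)$ if $\alpha<1$. -/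

import Mathlib

noncomputable section

namespace WeaklyAsymmetricBridge

open MeasureTheory ProbabilityTheory Filter

/-! ### Discrete bridges and the invariant measure -/

/-- Discrete bridges from `(0,0)` to `(2N,0)`, encoded by their `±1` steps: the `i`-th entry
(`i = 0, …, 2N-1`) is the step `X_{i+1}`, an element of `ℤˣ = {1,-1}`, and the steps sum to `0`. -/
def Bridge (N : ℕ) : Type := {X : Fin (2 * N) → ℤˣ // ∑ i, ((X i : ℤˣ) : ℤ) = 0}

instance (N : ℕ) : Fintype (Bridge N) :=
  inferInstanceAs (Fintype {X : Fin (2 * N) → ℤˣ // ∑ i, ((X i : ℤˣ) : ℤ) = 0})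

instance (N : ℕ) : MeasurableSpace (Bridge N) := ⊤

/-- The height `S(k) = X_1 + ⋯ + X_k`. -/
def height {N : ℕ} (S : Bridge N) (k : ℕ) : ℝ :=
  ∑ i : Fin (2 * N), if (i : ℕ) < k then (((S.1 i : ℤˣ) : ℤ) : ℝ) else 0

/-- The area `A(S) = ∑_{k=1}^{2N} S(k)`. -/
def area {N : ℕ} (S : Bridge N) : ℝ := ∑ k ∈ Finset.Icc 1 (2 * N), height S k

/-- The up-rate `p_N`, determined by `p_N / (1 - p_N) = exp (4σ / (2N)^α)`. -/
def upRate (σ α : ℝ) (N : ℕ) : ℝ :=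
  Real.exp (4 * σ / (2 * (N : ℝ)) ^ α) / (1 + Real.exp (4 * σ / (2 * (N : ℝ)) ^ α))

theorem upRate_div (σ α : ℝ) (N : ℕ) :
    upRate σ α N / (1 - upRate σ α N) = Real.exp (4 * σ / (2 * (N : ℝ)) ^ α) := by
  unfold upRate
  have h := Real.exp_pos (4 * σ / (2 * (N : ℝ)) ^ α)
  field_simp
  ring

/-- The unnormalised weight `(p_N / (1 - p_N)) ^ (A(S) / 2)`. -/
def weight (σ α : ℝ) {N : ℕ} (S : Bridge N) : ℝ :=
  (upRate σ α N / (1 - upRate σ α N)) ^ (area S / 2)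

/-- The partition function `Z_N`. -/
def partitionFn (σ α : ℝ) (N : ℕ) : ℝ := ∑ S : Bridge N, weight σ α S

/-- The invariant measure `μ_N(S) = Z_N⁻¹ (p_N / (1 - p_N)) ^ (A(S) / 2)`. -/
def invMeasure (σ α : ℝ) (N : ℕ) : Measure (Bridge N) :=
  ∑ S : Bridge N, ENNReal.ofReal (weight σ α S / partitionFn σ α N) • Measure.dirac S

theorem weight_pos (σ α : ℝ) {N : ℕ} (S : Bridge N) : 0 < weight σ α S := by
  unfold weight
  rw [upRate_div]
  positivity

instance (N : ℕ) : Nonempty (Bridge N) := by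
  refine ⟨⟨fun i => if (i : ℕ) < N then 1 else -1, ?_⟩⟩
  rw [Fin.sum_univ_eq_sum_range
    (fun i => (((if i < N then 1 else -1 : ℤˣ) : ℤˣ) : ℤ)) (2 * N), two_mul,
    Finset.sum_range_add]
  rw [Finset.sum_congr rfl (g := fun _ => (1 : ℤ))
    (fun i hi => by simp [Finset.mem_range.1 hi])]
  simp

instance (σ α : ℝ) (N : ℕ) : IsProbabilityMeasure (invMeasure σ α N) := by
  have hZ : 0 < partitionFn σ α N :=
    Finset.sum_pos (fun S _ => weight_pos σ α S) Finset.univ_nonempty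
  constructor
  simp only [invMeasure, Measure.coe_finsetSum, Finset.sum_apply, Measure.smul_apply,
    measure_univ, smul_eq_mul, mul_one]
  rw [← ENNReal.ofReal_sum_of_nonneg fun S _ => (div_pos (weight_pos σ α S) hZ).le,
    ← Finset.sum_div]
  rw [show ∑ S : Bridge N, weight σ α S = partitionFn σ α N from rfl, div_self hZ.ne']
  simp

/-! ### Piecewise affine interpolation -/

/-- The continuous function that equals `f k` at each integer `k ∈ {0, …, n}`, is affine on each
`[k, k+1]` with `0 ≤ k < n`, and is constant on `(-∞, 0]` and on `[n, ∞)`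
(see `interp_of_mem`, `interp_of_nonpos` and `interp_of_ge`). -/
def interp (n : ℕ) (f : ℕ → ℝ) (t : ℝ) : ℝ :=
  f 0 + ∑ k ∈ Finset.range n, (f (k + 1) - f k) * max 0 (min 1 (t - k))

theorem continuous_interp (n : ℕ) (f : ℕ → ℝ) : Continuous (interp n f) := by
  unfold interp
  fun_prop

theorem interp_of_ge (n : ℕ) (f : ℕ → ℝ) (t : ℝ) (ht : (n : ℝ) ≤ t) :
    interp n f t = f n := by
  unfold interp
  rw [Finset.sum_congr rfl (g := fun k => f (k + 1) - f k), Finset.sum_range_sub]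
  · ring
  · intro k hk
    have : ((k + 1 : ℕ) : ℝ) ≤ n := by exact_mod_cast Finset.mem_range.1 hk
    push_cast at this
    rw [min_eq_left (by linarith), max_eq_right zero_le_one, mul_one]

theorem interp_of_nonpos (n : ℕ) (f : ℕ → ℝ) (t : ℝ) (ht : t ≤ 0) :
    interp n f t = f 0 := by
  unfold interp
  rw [Finset.sum_eq_zero, add_zero]
  intro k _
  have : (0 : ℝ) ≤ k := k.cast_nonneg
  rw [max_eq_left ((min_le_right _ _).trans (by linarith)), mul_zero]

theorem interp_of_mem (n : ℕ) (f : ℕ → ℝ) (k : ℕ) (hk : k < n) (t : ℝ)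
    (ht : t ∈ Set.Icc (k : ℝ) (k + 1)) :
    interp n f t = f k + (t - k) * (f (k + 1) - f k) := by
  obtain ⟨m, rfl⟩ := Nat.exists_eq_add_of_lt hk
  have h1 := interp_of_ge k f t ht.1
  unfold interp at h1 ⊢
  rw [show k + m + 1 = (k + 1) + m by ring, Finset.sum_range_add, Finset.sum_range_succ,
    Finset.sum_eq_zero (s := Finset.range m)]
  · rw [min_eq_right (by linarith [ht.2]), max_eq_right (by linarith [ht.1])]
    linarith
  · intro j _
    have : (0 : ℝ) ≤ j := j.cast_nonneg
    push_cast
    rw [max_eq_left ((min_le_right _ _).trans (by linarith [ht.2])), mul_zero]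

/-! ### The centring curve and the rescaled fluctuations -/

/-- `L(h) = log cosh h`. -/
def logCosh (h : ℝ) : ℝ := Real.log (Real.cosh h)

/-- `h^N_i = (2σ / (2N)^α) (N - i + 1/2)`. -/
def tilt (σ α : ℝ) (N i : ℕ) : ℝ := 2 * σ / (2 * (N : ℝ)) ^ α * ((N : ℝ) - i + 1 / 2)

/-- The value `∑_{i=1}^k L'(h^N_i)` of the centring curve at the `k`-th grid point. -/
def centring (σ α : ℝ) (N k : ℕ) : ℝ := ∑ i ∈ Finset.Icc 1 k, deriv logCosh (tilt σ α N i)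

/-- The difference between the piecewise affine interpolations of `S` and of the centring curve,
as a function of the unrescaled space variable `t ∈ [0,2N]`. -/
def centredHeight (σ α : ℝ) {N : ℕ} (S : Bridge N) (t : ℝ) : ℝ :=
  interp (2 * N) (height S) t - interp (2 * N) (centring σ α N) t

theorem continuous_centredHeight (σ α : ℝ) {N : ℕ} (S : Bridge N) :
    Continuous (centredHeight σ α S) :=
  (continuous_interp _ _).sub (continuous_interp _ _)

/-- The rescaled fluctuations when `α ≥ 1`:
`u^N(x) = (S(2Nx) - Σ^N_α(x)) / √(2N)` for `x ∈ [0,1]`. -/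
def fluct (σ α : ℝ) {N : ℕ} (S : Bridge N) : C(unitInterval, ℝ) where
  toFun x := centredHeight σ α S ((x : ℝ) * (2 * N)) / Real.sqrt (2 * N)
  continuous_toFun :=
    ((continuous_centredHeight σ α S).comp (by fun_prop)).div_const _

/-- The rescaled fluctuations when `α < 1`:
`u^N(x) = (S(N + x (2N)^α) - Σ^N_α(x)) / (2N)^{α/2}` for `|x| ≤ N / (2N)^α`. It is extended to
`ℝ` by the constant values at the two ends of this interval (both of which are `0`). -/
def fluctWindow (σ α : ℝ) {N : ℕ} (S : Bridge N) : C(ℝ, ℝ) where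
  toFun x := centredHeight σ α S (N + x * (2 * (N : ℝ)) ^ α) / (2 * (N : ℝ)) ^ (α / 2)
  continuous_toFun :=
    ((continuous_centredHeight σ α S).comp (by fun_prop)).div_const _

/-! ### Path spaces, Brownian bridge and the function `q_α` -/

/-- Spaces of continuous functions carry the topology of uniform convergence on compact sets
and its Borel sigma-field. -/
instance {X : Type*} [TopologicalSpace X] : MeasurableSpace C(X, ℝ) := borel _

instance {X : Type*} [TopologicalSpace X] : BorelSpace C(X, ℝ) := ⟨rfl⟩

/-- `b` is a (standard) Brownian bridge on `[0,1]` under `P`: a random continuous function which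
is a centred Gaussian process with covariance `s (1 - t)` for `s ≤ t`. -/
structure IsBrownianBridge {Ω : Type*} [MeasurableSpace Ω] (b : Ω → C(unitInterval, ℝ))
    (P : Measure Ω) : Prop where
  measurable : Measurable b
  isGaussianProcess : IsGaussianProcess (fun (t : unitInterval) (ω : Ω) => b ω t) P
  mean : ∀ t : unitInterval, ∫ ω, b ω t ∂P = 0
  covariance : ∀ s t : unitInterval, s ≤ t →
    cov[fun ω => b ω s, fun ω => b ω t; P] = (s : ℝ) * (1 - (t : ℝ))

/-- The integrand in the definition of `q_α`: `1` if `α > 1`, `L''(σ(1-2u))` if `α = 1`, and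
`L''(2σu)` if `α < 1`. -/
def qDensity (σ α u : ℝ) : ℝ :=
  if 1 < α then 1
  else if α = 1 then deriv (deriv logCosh) (σ * (1 - 2 * u))
  else deriv (deriv logCosh) (2 * σ * u)

/-- `q_α`, as a function of the (possibly unbounded) interval `J` over which one integrates. -/
def q (σ α : ℝ) (J : Set ℝ) : ℝ := ∫ u in J, qDensity σ α u

end WeaklyAsymmetricBridge

end

open MeasureTheory ProbabilityTheory Filter WeaklyAsymmetricBridge

universe v

/-! The weight of a bridge is the exponential of a linear form in its steps. Since the steps sum to
`0`, a constant may be subtracted from the coefficients, which turns them into the tilts `h_i`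
(`weight_eq`). Hence `μ_N` is the law of independent `±1` steps with `P(X_i = ±1)` proportional to
`exp (±h_i)`, with mean `tanh h_i = L'(h_i)` and variance `sech² h_i = L''(h_i)`, conditioned on a
vanishing sum. The tilts are antisymmetric under reversal, so the unconditioned sum is centred, and
the conditioning is on its mean value.

The conditioning is made explicit by Fourier inversion. Since the sum of the steps is even, the
indicator that it vanishes is an average of `exp (i t ∑ X)` over `|t| ≤ π/2`. Every exponential
moment of the centred steps is therefore a ratio of two integrals of products of one-step transforms
(`integral_exp_bridge`). This identity is used twice.

With imaginary arguments of order `1/√a`, where `a` is the space scale, a local limit theorem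
(`tendsto_contour`) turns the integrals into Gaussian ones. Completing the square yields the
exponent `-(m₂ - m₁²/Q)/2`, in which the correction `m₁²/Q` is the effect of the conditioning. With
real arguments, the same ratio is bounded uniformly, which gives a fourth moment bound of order `(t
- s)²` for the increments of the path, hence tightness by a dyadic chaining argument and
Arzelà–Ascoli (`isTightMeasureSet_of_moment_bound`).

Tightness and convergence of the characteristic functionals `θ ↦ E exp (i ∑ θ(x) u(x))` together
give weak convergence. They also produce a limit law, and this is how the Brownian bridge is shown
to exist. The limit covariance is `F (min x y) - F x * F y / Q`, where `F` is the limiting variance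
profile and `Q` its total mass. It is the covariance of `√Q b(F/Q)`.

What depends on `α` is only the computation of `F` (`tendsto_partialVariance_div`): consecutive
tilts differ by the slope, so `sech²` of a tilt is, up to a factor tending to `1`, an increment of
`tanh` divided by the slope, and the sum telescopes. All regimes are treated in `C(ℝ, ℝ)`. For `α ≥
1` the paths are constant outside `[0,1]`, and the result is restricted to `[0,1]` at the end. -/

namespace WeaklyAsymmetricBridge
open scoped Topology

/-! ### Hyperbolic functions -/

/-- The variance `sech² h` of a tilted `±1` step. -/
noncomputable def sechSq (h : ℝ) : ℝ := 1 / Real.cosh h ^ 2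

lemma sechSq_pos (h : ℝ) : 0 < sechSq h := by
  have := Real.cosh_pos h
  unfold sechSq; positivity

lemma sechSq_le_one (h : ℝ) : sechSq h ≤ 1 := by
  unfold sechSq
  rw [div_le_one (by have := Real.cosh_pos h; positivity)]
  exact one_le_pow₀ (Real.one_le_cosh h)

lemma sechSq_neg (h : ℝ) : sechSq (-h) = sechSq h := by simp [sechSq]

lemma sechSq_eq (h : ℝ) : sechSq h = 1 - Real.tanh h ^ 2 := by
  have := (Real.cosh_pos h).ne'
  rw [sechSq, Real.tanh_eq_sinh_div_cosh]
  field_simp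
  rw [Real.cosh_sq]; ring

lemma continuous_sechSq : Continuous sechSq := by
  unfold sechSq
  exact continuous_const.div (Real.continuous_cosh.pow 2)
    fun h => by have := Real.cosh_pos h; positivity

lemma hasDerivAt_tanh (h : ℝ) : HasDerivAt Real.tanh (sechSq h) h := by
  have h0 := (Real.cosh_pos h).ne'
  have := (Real.hasDerivAt_sinh h).div (Real.hasDerivAt_cosh h) h0
  have e : (Real.sinh / Real.cosh) = Real.tanh := by
    funext x; simp [Real.tanh_eq_sinh_div_cosh]
  rw [e] at this
  refine this.congr_deriv ?_
  unfold sechSq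
  congr 1
  have := Real.cosh_sq h
  linarith

lemma continuous_tanh : Continuous Real.tanh :=
  continuous_iff_continuousAt.2 fun h => (hasDerivAt_tanh h).continuousAt

lemma monotone_tanh : Monotone Real.tanh := by
  apply monotone_of_deriv_nonneg (fun h => (hasDerivAt_tanh h).differentiableAt)
  intro h
  rw [(hasDerivAt_tanh h).deriv]
  exact (sechSq_pos h).le

lemma monotone_sub_tanh : Monotone fun h : ℝ => h - Real.tanh h := by
  have hd : ∀ h, HasDerivAt (fun h : ℝ => h - Real.tanh h) (1 - sechSq h) h :=
    fun h => (hasDerivAt_id h).sub (hasDerivAt_tanh h)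
  apply monotone_of_deriv_nonneg (fun h => (hd h).differentiableAt)
  intro h
  rw [(hd h).deriv]
  linarith [sechSq_le_one h]

lemma abs_tanh_sub_tanh_le (x y : ℝ) : |Real.tanh x - Real.tanh y| ≤ |x - y| := by
  rcases le_total x y with h | h
  · rw [abs_of_nonpos (sub_nonpos.2 (monotone_tanh h)), abs_of_nonpos (sub_nonpos.2 h)]
    have := monotone_sub_tanh h
    simp only at this; linarith
  · rw [abs_of_nonneg (sub_nonneg.2 (monotone_tanh h)), abs_of_nonneg (sub_nonneg.2 h)]
    have := monotone_sub_tanh h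
    simp only at this; linarith

lemma hasDerivAt_logCosh (h : ℝ) : HasDerivAt logCosh (Real.tanh h) h := by
  have := (Real.hasDerivAt_cosh h).log (Real.cosh_pos h).ne'
  rwa [← Real.tanh_eq_sinh_div_cosh] at this

lemma deriv_logCosh : deriv logCosh = Real.tanh := funext fun h => (hasDerivAt_logCosh h).deriv

lemma deriv_deriv_logCosh : deriv (deriv logCosh) = sechSq := by
  rw [deriv_logCosh]; exact funext fun h => (hasDerivAt_tanh h).deriv

/-- Hoeffding's inequality for a tilted `±1` step. -/
lemma cosh_add_le (h l : ℝ) :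
    Real.cosh (h + l) ≤ Real.cosh h * Real.exp (l * Real.tanh h + l ^ 2 / 2) := by
  let g : ℝ → ℝ := fun l => l * Real.tanh h + l ^ 2 / 2 - logCosh (h + l)
  have hd : ∀ l, HasDerivAt g (Real.tanh h + l - Real.tanh (h + l)) l := by
    intro l
    have h1 := ((hasDerivAt_id l).mul_const (Real.tanh h)).add
      (((hasDerivAt_id l).pow 2).div_const 2)
    have h2 : HasDerivAt (fun l => logCosh (h + l)) (Real.tanh (h + l)) l := by
      simpa using (hasDerivAt_logCosh (h + l)).comp_const_add h l
    refine (h1.sub h2).congr_deriv ?_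
    simp
  have hc : Continuous g := continuous_iff_continuousAt.2 fun l => (hd l).continuousAt
  have key : g 0 ≤ g l := by
    rcases le_total 0 l with hl | hl
    · refine monotoneOn_of_deriv_nonneg (convex_Ici (0 : ℝ)) hc.continuousOn
        (fun x _ => (hd x).differentiableAt.differentiableWithinAt) (fun x hx => ?_)
        (Set.mem_Ici.2 le_rfl) (Set.mem_Ici.2 hl) hl
      rw [interior_Ici, Set.mem_Ioi] at hx
      rw [(hd x).deriv]
      have := abs_le.1 (abs_tanh_sub_tanh_le (h + x) h)
      rw [add_sub_cancel_left, abs_of_pos hx] at this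
      linarith
    · refine antitoneOn_of_deriv_nonpos (convex_Iic (0 : ℝ)) hc.continuousOn
        (fun x _ => (hd x).differentiableAt.differentiableWithinAt) (fun x hx => ?_)
        (Set.mem_Iic.2 hl) (Set.mem_Iic.2 le_rfl) hl
      rw [interior_Iic, Set.mem_Iio] at hx
      rw [(hd x).deriv]
      have := abs_le.1 (abs_tanh_sub_tanh_le (h + x) h)
      rw [add_sub_cancel_left, abs_of_neg hx] at this
      linarith
  have e : Real.log (Real.cosh (h + l)) ≤
      Real.log (Real.cosh h * Real.exp (l * Real.tanh h + l ^ 2 / 2)) := by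
    rw [Real.log_mul (Real.cosh_pos h).ne' (Real.exp_pos _).ne', Real.log_exp]
    simp only [g, logCosh, zero_mul, add_zero] at key
    norm_num at key
    linarith
  exact (Real.log_le_log_iff (Real.cosh_pos _) (by have := Real.cosh_pos h; positivity)).1 e

lemma cosh_add_le_exp_mul (h l : ℝ) : Real.cosh (h + l) ≤ Real.exp |l| * Real.cosh h := by
  have h1 : |Real.sinh h| ≤ Real.cosh h := by
    rw [Real.abs_sinh, ← Real.cosh_abs h]; exact (Real.sinh_lt_cosh _).le
  rw [Real.cosh_add, ← Real.cosh_abs l, ← Real.cosh_add_sinh |l|, add_mul]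
  have h2 : Real.sinh h * Real.sinh l ≤ Real.sinh |l| * Real.cosh h := by
    calc _ ≤ |Real.sinh h * Real.sinh l| := le_abs_self _
      _ = |Real.sinh h| * Real.sinh |l| := by rw [abs_mul, Real.abs_sinh l]
      _ ≤ _ := by
        rw [mul_comm]
        exact mul_le_mul_of_nonneg_left h1 (Real.sinh_nonneg_iff.2 (abs_nonneg l))
  linarith

/-- A shift of the tilt by at most `1` multiplies `cosh` by at most `e`, and `e² < 8`. Thus the
variance, and with it the Fourier decay, survives a bounded real shift. -/
lemma sechSq_div_eight_le (h l : ℝ) (hl : |l| ≤ 1) : sechSq h / 8 ≤ sechSq (h + l) := by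
  have h1 := cosh_add_le_exp_mul h l
  have h2 : Real.exp |l| ≤ 2.7182818286 :=
    (Real.exp_le_exp.2 hl).trans Real.exp_one_lt_d9.le
  have h3 := Real.cosh_pos h
  have h4 := Real.cosh_pos (h + l)
  unfold sechSq
  rw [div_div, div_le_div_iff₀ (by positivity) (by positivity)]
  have h5 : Real.cosh (h + l) ≤ 2.7182818286 * Real.cosh h :=
    h1.trans (mul_le_mul_of_nonneg_right h2 h3.le)
  nlinarith

/-! ### The centred exponential moments of a tilted step -/

/-- `E[exp (z (X - E X))]` for a `±1` valued `X` with `P(X = ±1)` proportional to `exp (±h)`. -/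
noncomputable def stepTransform (h : ℝ) (z : ℂ) : ℂ :=
  Complex.cosh (h + z) / Real.cosh h * Complex.exp (-(z * Real.tanh h))

lemma continuous_stepTransform (h : ℝ) : Continuous (stepTransform h) := by
  unfold stepTransform
  have : Continuous Complex.cosh := Complex.continuous_cosh
  fun_prop

lemma norm_cosh_sq (x t : ℝ) :
    ‖Complex.cosh (x + Complex.I * t)‖ ^ 2 = Real.cosh x ^ 2 - Real.sin t ^ 2 := by
  have : Complex.cosh (x + Complex.I * t) =
      ((Real.cosh x * Real.cos t : ℝ) : ℂ) + ((Real.sinh x * Real.sin t : ℝ) : ℂ) * Complex.I := by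
    rw [mul_comm Complex.I, Complex.cosh_add, Complex.cosh_mul_I, Complex.sinh_mul_I]
    push_cast; ring
  rw [this, Complex.sq_norm, Complex.normSq_add_mul_I, mul_pow, mul_pow, Real.sinh_sq,
    Real.cos_sq']
  ring

/-- The real part costs the Hoeffding factor `exp (l²/2)`, and the imaginary part gains decay from
`|cosh (h + l + i t)|² = cosh² (h + l) (1 - sech² (h + l) sin² t)` and `1 - x ≤ exp (-x)`. The `8`
of `sechSq_div_eight_le` becomes `16` on taking the square root. -/
lemma norm_stepTransform_le (h l t : ℝ) (hl : |l| ≤ 1) :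
    ‖stepTransform h (l + Complex.I * t)‖ ≤
      Real.exp (l ^ 2 / 2) * Real.exp (-(sechSq h * Real.sin t ^ 2 / 16)) := by
  have c0 := Real.cosh_pos h
  have c1 := Real.cosh_pos (h + l)
  have hn : ‖stepTransform h (l + Complex.I * t)‖ =
      ‖Complex.cosh (((h + l : ℝ) : ℂ) + Complex.I * t)‖ / Real.cosh h *
        Real.exp (-(l * Real.tanh h)) := by
    unfold stepTransform
    rw [norm_mul, norm_div, Complex.norm_exp, Complex.norm_real, Real.norm_eq_abs, abs_of_pos c0]
    congr 3
    · push_cast; ring_nf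
    · simp [-Complex.ofReal_tanh]
  have h1 : ‖Complex.cosh (((h + l : ℝ) : ℂ) + Complex.I * t)‖ ≤
      Real.cosh (h + l) * Real.exp (-(sechSq h * Real.sin t ^ 2 / 16)) := by
    refine le_of_sq_le_sq ?_ (by positivity) 
    rw [norm_cosh_sq, mul_pow, ← Real.exp_nat_mul]
    have h2 : 1 - sechSq h * Real.sin t ^ 2 / 8 ≤
        Real.exp ((2 : ℕ) * -(sechSq h * Real.sin t ^ 2 / 16)) := by
      have := Real.add_one_le_exp ((2 : ℕ) * -(sechSq h * Real.sin t ^ 2 / 16))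
      push_cast at this ⊢
      linarith
    have h3 : sechSq h / 8 * Real.sin t ^ 2 ≤ sechSq (h + l) * Real.sin t ^ 2 :=
      mul_le_mul_of_nonneg_right (sechSq_div_eight_le h l hl) (sq_nonneg _)
    have h4 : Real.cosh (h + l) ^ 2 * sechSq (h + l) = 1 := by
      unfold sechSq; field_simp
    calc _ = Real.cosh (h + l) ^ 2 * (1 - sechSq (h + l) * Real.sin t ^ 2) := by
          linear_combination (Real.sin t ^ 2) * h4
      _ ≤ Real.cosh (h + l) ^ 2 * (1 - sechSq h * Real.sin t ^ 2 / 8) := by gcongr; linarith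
      _ ≤ _ := by gcongr
  rw [hn]
  calc _ ≤ Real.cosh h * Real.exp (l * Real.tanh h + l ^ 2 / 2) *
        Real.exp (-(sechSq h * Real.sin t ^ 2 / 16)) / Real.cosh h *
        Real.exp (-(l * Real.tanh h)) := by
        gcongr
        exact h1.trans (mul_le_mul_of_nonneg_right (cosh_add_le h l) (Real.exp_pos _).le)
    _ = _ := by
        rw [Real.exp_add, Real.exp_neg (l * _)]
        field_simp

lemma norm_stepTransform_I_le (h t : ℝ) :
    ‖stepTransform h (Complex.I * t)‖ ≤ Real.exp (-(sechSq h * Real.sin t ^ 2 / 16)) := by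
  simpa using norm_stepTransform_le h 0 t (by simp)

lemma norm_stepTransform_I_le_one (h t : ℝ) : ‖stepTransform h (Complex.I * t)‖ ≤ 1 := by
  refine (norm_stepTransform_I_le h t).trans (Real.exp_le_one_iff.2 ?_)
  have := sechSq_pos h
  simp only [Left.neg_nonpos_iff]; positivity

/-- The form suited to Taylor expansion: an explicit average over the two values `±1 - tanh h` of
the centred step. -/
lemma stepTransform_eq (h : ℝ) (z : ℂ) :
    stepTransform h z = ((1 + Real.tanh h) / 2 : ℝ) * Complex.exp (z * (1 - Real.tanh h : ℝ)) +
      ((1 - Real.tanh h) / 2 : ℝ) * Complex.exp (z * (-1 - Real.tanh h : ℝ)) := by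
  have h0 : Complex.cosh h ≠ 0 := by
    rw [← Complex.ofReal_cosh]; exact_mod_cast (Real.cosh_pos h).ne'
  have e1 : Complex.exp (z * (1 - Real.tanh h : ℝ)) =
      (Complex.cosh z + Complex.sinh z) * Complex.exp (-(z * Real.tanh h)) := by
    rw [Complex.cosh_add_sinh, ← Complex.exp_add]; congr 1; push_cast; ring
  have e2 : Complex.exp (z * (-1 - Real.tanh h : ℝ)) =
      (Complex.cosh z - Complex.sinh z) * Complex.exp (-(z * Real.tanh h)) := by
    rw [Complex.cosh_sub_sinh, ← Complex.exp_add]; congr 1; push_cast; ring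
  rw [e1, e2, stepTransform, Complex.cosh_add]
  push_cast
  rw [Complex.tanh_eq_sinh_div_cosh]
  field_simp
  ring

lemma norm_exp_sub_quadratic_le (z : ℂ) (hz : ‖z‖ ≤ 1) :
    ‖Complex.exp z - (1 + z + z ^ 2 / 2)‖ ≤ ‖z‖ ^ 3 * (2 / 9) := by
  have := Complex.exp_bound hz (n := 3) (by norm_num)
  norm_num [Finset.sum_range_succ, Nat.factorial] at this
  convert this using 2

/-- The factor `sechSq h` in the error is essential: summed over the steps, the errors are then
controlled by the total variance, which for `α < 1` is much smaller than the number of steps. It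
comes from the third absolute moment of the centred step, `(1 - m²)(1 + m²)` with `m = tanh h`. -/
lemma norm_stepTransform_sub_exp_le (h u : ℝ) (hu : |u| ≤ 1 / 2) :
    ‖stepTransform h (Complex.I * u) - (Real.exp (-(sechSq h * u ^ 2 / 2)) : ℝ)‖ ≤
      sechSq h * |u| ^ 3 := by
  set m := Real.tanh h with hm
  have hm1 : |m| ≤ 1 := (Real.abs_tanh_lt_one h).le
  have hm2 := abs_le.1 hm1
  have hv : sechSq h = 1 - m ^ 2 := sechSq_eq h
  have hv0 := sechSq_pos h
  have hv1 := sechSq_le_one h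
  have b (y : ℝ) (hy : |y| ≤ 2) : ‖Complex.exp (Complex.I * u * (y : ℝ)) -
      (1 + Complex.I * u * y + (Complex.I * u * y) ^ 2 / 2)‖ ≤ (|u| * |y|) ^ 3 * (2 / 9) := by
    have hn : ‖Complex.I * u * (y : ℂ)‖ = |u| * |y| := by simp
    rw [← hn]
    apply norm_exp_sub_quadratic_le
    rw [hn]
    nlinarith [abs_nonneg u, abs_nonneg y]
  have b1 := b (1 - m) (by rw [abs_le]; constructor <;> linarith)
  have b2 := b (-1 - m) (by rw [abs_le]; constructor <;> linarith)
  have b3 : |Real.exp (-(sechSq h * u ^ 2 / 2)) - (1 - sechSq h * u ^ 2 / 2)| ≤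
      (sechSq h * u ^ 2 / 2) ^ 2 := by
    have hu2 : u ^ 2 ≤ 1 / 4 := by rw [← sq_abs]; nlinarith [abs_nonneg u]
    have := Real.norm_exp_sub_one_sub_id_le (x := -(sechSq h * u ^ 2 / 2)) (by
      rw [Real.norm_eq_abs, abs_neg, abs_of_nonneg (by positivity)]; nlinarith)
    rw [Real.norm_eq_abs, Real.norm_eq_abs, sq_abs, neg_sq] at this
    convert this using 2; ring
  rw [abs_of_nonneg (by linarith : (0:ℝ) ≤ 1 - m)] at b1
  rw [abs_of_nonpos (by linarith : -1 - m ≤ (0:ℝ))] at b2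
  -- The centred step has mean `0` and variance `1 - m²`, so the quadratic Taylor polynomials
  -- average to `1 - sechSq h * u² / 2`, and only remainders are left.
  have dec : stepTransform h (Complex.I * u) - (Real.exp (-(sechSq h * u ^ 2 / 2)) : ℝ) =
      ((1 + m) / 2 : ℝ) * (Complex.exp (Complex.I * u * (1 - m : ℝ)) -
        (1 + Complex.I * u * (1 - m : ℝ) + (Complex.I * u * (1 - m : ℝ)) ^ 2 / 2)) +
      ((1 - m) / 2 : ℝ) * (Complex.exp (Complex.I * u * (-1 - m : ℝ)) -
        (1 + Complex.I * u * (-1 - m : ℝ) + (Complex.I * u * (-1 - m : ℝ)) ^ 2 / 2)) -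
      ((Real.exp (-(sechSq h * u ^ 2 / 2)) - (1 - sechSq h * u ^ 2 / 2) : ℝ) : ℂ) := by
    rw [stepTransform_eq, hv, ← hm]
    push_cast
    linear_combination ((1 - m ^ 2) * u ^ 2 / 2 : ℂ) * Complex.I_sq
  rw [dec]
  have hu3 : u ^ 4 ≤ |u| ^ 3 / 2 := by
    have : u ^ 4 = |u| ^ 4 := by rw [pow_abs, abs_of_nonneg (by positivity)]
    rw [this, pow_succ]; have := pow_nonneg (abs_nonneg u) 3; nlinarith
  have hu4 := pow_nonneg (abs_nonneg u) 3
  calc _ ≤ (1 + m) / 2 * ((|u| * (1 - m)) ^ 3 * (2 / 9)) +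
        (1 - m) / 2 * ((|u| * (-(-1 - m))) ^ 3 * (2 / 9)) + (sechSq h * u ^ 2 / 2) ^ 2 := by
        refine (norm_sub_le _ _).trans (add_le_add ((norm_add_le _ _).trans (add_le_add ?_ ?_)) ?_)
        · rw [norm_mul, Complex.norm_real, Real.norm_eq_abs, abs_of_nonneg (by linarith)]
          exact mul_le_mul_of_nonneg_left b1 (by linarith)
        · rw [norm_mul, Complex.norm_real, Real.norm_eq_abs, abs_of_nonneg (by linarith)]
          exact mul_le_mul_of_nonneg_left b2 (by linarith)
        · rw [Complex.norm_real, Real.norm_eq_abs]; exact b3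
    _ = (1 - m ^ 2) * |u| ^ 3 * ((1 + m ^ 2) * (2 / 9)) + sechSq h ^ 2 * u ^ 4 / 4 := by ring
    _ ≤ sechSq h * |u| ^ 3 * (4 / 9) + sechSq h * |u| ^ 3 / 8 := by
        rw [← hv]
        have h1 : sechSq h ^ 2 * u ^ 4 ≤ sechSq h * (|u| ^ 3 / 2) := by
          apply mul_le_mul _ hu3 (by positivity) hv0.le
          nlinarith
        have h2 : (1 + m ^ 2) * (2 / 9) ≤ 4 / 9 := by nlinarith
        have h3 := mul_le_mul_of_nonneg_left h2 (mul_nonneg hv0.le hu4)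
        linarith
    _ ≤ _ := by have := mul_nonneg hv0.le hu4; linarith

/-- Replace the factors one at a time; all the others have norm at most `1`. -/
lemma norm_prod_sub_prod_le {ι : Type*} (s : Finset ι) (f g : ι → ℂ)
    (hf : ∀ i ∈ s, ‖f i‖ ≤ 1) (hg : ∀ i ∈ s, ‖g i‖ ≤ 1) :
    ‖∏ i ∈ s, f i - ∏ i ∈ s, g i‖ ≤ ∑ i ∈ s, ‖f i - g i‖ := by
  classical
  induction s using Finset.induction_on with
  | empty => simp
  | insert a s ha ih =>
    rw [Finset.prod_insert ha, Finset.prod_insert ha, Finset.sum_insert ha]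
    have ih' := ih (fun i hi => hf i (Finset.mem_insert_of_mem hi))
      (fun i hi => hg i (Finset.mem_insert_of_mem hi))
    have hp : ‖∏ i ∈ s, f i‖ ≤ 1 := by
      rw [norm_prod]
      exact Finset.prod_le_one (fun i _ => norm_nonneg _)
        fun i hi => hf i (Finset.mem_insert_of_mem hi)
    have hga := hg a (Finset.mem_insert_self _ _)
    calc _ = ‖(f a - g a) * ∏ i ∈ s, f i + g a * (∏ i ∈ s, f i - ∏ i ∈ s, g i)‖ := by
          congr 1; ring
      _ ≤ ‖f a - g a‖ * ‖∏ i ∈ s, f i‖ + ‖g a‖ * ‖∏ i ∈ s, f i - ∏ i ∈ s, g i‖ := by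
          refine (norm_add_le _ _).trans ?_
          rw [norm_mul, norm_mul]
      _ ≤ ‖f a - g a‖ * 1 + 1 * ‖∏ i ∈ s, f i - ∏ i ∈ s, g i‖ := by gcongr
      _ ≤ _ := by linarith

end WeaklyAsymmetricBridge

namespace WeaklyAsymmetricBridge
open scoped Topology

/-! ### Exponential moments under the invariant measure -/

/-- The `i`-th step of a bridge, as a real number. -/
noncomputable def step {N : ℕ} (S : Bridge N) (i : Fin (2 * N)) : ℝ := (((S.1 i : ℤˣ) : ℤ) : ℝ)

lemma sum_step {N : ℕ} (S : Bridge N) : ∑ i, step S i = 0 := by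
  have := congrArg (fun z : ℤ => (z : ℝ)) S.2
  simpa [step] using this

/-- The tilt of the `i`-th step, with `0`-based indices. -/
noncomputable def stepTilt (σ α : ℝ) (N : ℕ) (i : Fin (2 * N)) : ℝ := tilt σ α N (i + 1)

lemma area_eq {N : ℕ} (S : Bridge N) :
    area S = ∑ i : Fin (2 * N), step S i * (2 * N - (i : ℕ)) := by
  unfold area height
  rw [Finset.sum_comm]
  refine Finset.sum_congr rfl fun i _ => ?_
  rw [← Finset.sum_filter, Finset.sum_const, nsmul_eq_mul, mul_comm, step]
  congr 1
  have : (Finset.Icc 1 (2 * N)).filter (fun k => (i : ℕ) < k) = Finset.Icc (i + 1 : ℕ) (2 * N) := by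
    ext k; simp only [Finset.mem_filter, Finset.mem_Icc]; omega
  rw [this, Nat.card_Icc, show 2 * N + 1 - (i + 1 : ℕ) = 2 * N - i by omega,
    Nat.cast_sub i.2.le]
  push_cast; ring

/-- By `area_eq` the coefficients are a multiple of `2N - i`. Because the steps sum to `0`, the
constant `N + 1/2` can be subtracted from `2N - i`, which makes the coefficients antisymmetric under
reversal of the steps. -/
lemma weight_eq (σ α : ℝ) {N : ℕ} (S : Bridge N) :
    weight σ α S = Real.exp (∑ i, stepTilt σ α N i * step S i) := by
  rw [weight, upRate_div, ← Real.exp_mul, area_eq]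
  congr 1
  have h := sum_step S
  have : ∑ i, stepTilt σ α N i * step S i =
      2 * σ / (2 * (N : ℝ)) ^ α * ∑ i : Fin (2 * N), step S i * (2 * N - (i : ℕ)) -
      2 * σ / (2 * (N : ℝ)) ^ α * (N + 1 / 2) * ∑ i, step S i := by
    rw [Finset.mul_sum, Finset.mul_sum, ← Finset.sum_sub_distrib]
    refine Finset.sum_congr rfl fun i _ => ?_
    simp only [stepTilt, tilt]; push_cast; ring
  rw [this, h]
  ring

lemma partitionFn_pos (σ α : ℝ) (N : ℕ) : 0 < partitionFn σ α N :=
  Finset.sum_pos (fun S _ => weight_pos σ α S) Finset.univ_nonempty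

lemma integrable_invMeasure {E : Type*} [NormedAddCommGroup E] [NormedSpace ℝ E] (σ α : ℝ) {N : ℕ}
    (g : Bridge N → E) : Integrable g (invMeasure σ α N) := by
  unfold invMeasure
  refine integrable_finsetSum_measure.2 fun S _ => Integrable.smul_measure ?_ (by simp)
  exact integrable_dirac (by simp [enorm_lt_top])

lemma integral_invMeasure {E : Type*} [NormedAddCommGroup E] [NormedSpace ℝ E] [CompleteSpace E]
    (σ α : ℝ) {N : ℕ} (g : Bridge N → E) :
    ∫ S, g S ∂(invMeasure σ α N) = ∑ S, (weight σ α S / partitionFn σ α N) • g S := by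
  unfold invMeasure
  rw [integral_finsetSum_measure]
  · refine Finset.sum_congr rfl fun S _ => ?_
    rw [integral_smul_measure, integral_dirac, ENNReal.toReal_ofReal]
    exact (div_pos (weight_pos σ α S) (partitionFn_pos σ α N)).le
  · exact fun S _ => (integrable_dirac (by simp [enorm_lt_top])).smul_measure (by simp)

lemma prod_two_cosh {n : ℕ} (w : Fin n → ℂ) :
    ∏ i, (2 * Complex.cosh (w i)) =
      ∑ X : Fin n → ℤˣ, Complex.exp (∑ i, w i * (((X i : ℤˣ) : ℤ) : ℂ)) := by
  have (i : Fin n) : 2 * Complex.cosh (w i) =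
      ∑ x : ℤˣ, Complex.exp (w i * (((x : ℤˣ) : ℤ) : ℂ)) := by
    rw [Complex.two_cosh, Fintype.sum_eq_add (1 : ℤˣ) (-1) (by decide)
      (fun x hx => by rcases Int.units_eq_one_or x with h | h <;> simp_all)]
    simp
  simp_rw [this, Finset.prod_univ_sum, Fintype.piFinset_univ, Complex.exp_sum]

lemma even_sum_units {N : ℕ} (X : Fin (2 * N) → ℤˣ) : Even (∑ i, ((X i : ℤˣ) : ℤ)) := by
  have h : ∀ i, ∃ k : ℤ, ((X i : ℤˣ) : ℤ) = 1 + 2 * k := fun i => by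
    rcases Int.units_eq_one_or (X i) with h | h
    · exact ⟨0, by simp [h]⟩
    · exact ⟨-1, by simp [h]⟩
  choose k hk using h
  refine ⟨N + ∑ i, k i, ?_⟩
  simp_rw [hk, Finset.sum_add_distrib, ← Finset.mul_sum]
  simp; ring

/-- For even `m` the integrand has period `π`, so an interval of length `π` suffices. This keeps the
range within `|t| ≤ π/2`, where `sin² t` is bounded below by a multiple of `t²`. -/
lemma integral_exp_I_even (m : ℤ) (hm : Even m) :
    ∫ t in (-(Real.pi / 2))..(Real.pi / 2), Complex.exp (Complex.I * t * m) =
      if m = 0 then (Real.pi : ℂ) else 0 := by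
  split_ifs with h
  · subst h
    simp
  · have hI : Complex.I * (m : ℂ) ≠ 0 := mul_ne_zero Complex.I_ne_zero (by exact_mod_cast h)
    have := integral_exp_mul_complex (a := -(Real.pi / 2)) (b := Real.pi / 2) hI
    rw [show (fun t : ℝ => Complex.exp (Complex.I * t * m)) =
      fun t : ℝ => Complex.exp (Complex.I * m * t) by funext t; congr 1; ring, this]
    obtain ⟨k, rfl⟩ := hm
    rw [div_eq_zero_iff]
    left
    rw [sub_eq_zero, Complex.exp_eq_exp_iff_exists_int]
    exact ⟨k, by push_cast; ring⟩

/-- Fourier inversion: expanding the product of `2 cosh` gives a sum over all sequences of signs,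
and the integral in `t` keeps those with vanishing sum. -/
lemma sum_bridge_exp {N : ℕ} (z : Fin (2 * N) → ℂ) :
    (Real.pi : ℂ) * ∑ S : Bridge N, Complex.exp (∑ i, z i * (step S i : ℂ)) =
      ∫ t in (-(Real.pi / 2))..(Real.pi / 2), ∏ i, (2 * Complex.cosh (z i + Complex.I * t)) := by
  simp_rw [prod_two_cosh]
  rw [intervalIntegral.integral_finsetSum]
  · have (X : Fin (2 * N) → ℤˣ) : ∫ t in (-(Real.pi / 2))..(Real.pi / 2),
        Complex.exp (∑ i, (z i + Complex.I * t) * (((X i : ℤˣ) : ℤ) : ℂ)) =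
        if ∑ i, ((X i : ℤˣ) : ℤ) = 0 then
          Real.pi * Complex.exp (∑ i, z i * (((X i : ℤˣ) : ℤ) : ℂ)) else 0 := by
      have e : ∀ t : ℝ, Complex.exp (∑ i, (z i + Complex.I * t) * (((X i : ℤˣ) : ℤ) : ℂ)) =
          Complex.exp (∑ i, z i * (((X i : ℤˣ) : ℤ) : ℂ)) *
            Complex.exp (Complex.I * t * (∑ i, ((X i : ℤˣ) : ℤ) : ℤ)) := by
        intro t
        rw [← Complex.exp_add]
        congr 1
        push_cast
        rw [Finset.mul_sum, ← Finset.sum_add_distrib]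
        exact Finset.sum_congr rfl fun i _ => by ring
      simp_rw [e]
      rw [intervalIntegral.integral_const_mul, integral_exp_I_even _ (even_sum_units X)]
      split_ifs <;> ring
    simp_rw [this]
    rw [← Finset.sum_filter, ← Finset.mul_sum]
    congr 1
    simp only [step, Complex.ofReal_intCast]
    exact (Finset.sum_subtype (F := (inferInstance : Fintype (Bridge N))) _
      (p := fun X : Fin (2 * N) → ℤˣ => ∑ i, ((X i : ℤˣ) : ℤ) = 0)
      (fun X => by simp) (fun X => Complex.exp (∑ i, z i * (((X i : ℤˣ) : ℤ) : ℂ)))).symm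
  · intro X _
    exact Continuous.intervalIntegrable (by fun_prop) _ _

/-- Reversing the order of the steps changes the sign of every tilt. -/
lemma sum_tanh_stepTilt (σ α : ℝ) (N : ℕ) : ∑ i, Real.tanh (stepTilt σ α N i) = 0 := by
  have h : ∑ i, Real.tanh (stepTilt σ α N i) = ∑ i, -Real.tanh (stepTilt σ α N i) := by
    rw [← Equiv.sum_comp Fin.revPerm]
    refine Finset.sum_congr rfl fun i _ => ?_
    rw [← Real.tanh_neg]
    congr 1
    simp only [stepTilt, tilt, Fin.revPerm_apply, Fin.val_rev]
    rw [show (2 * N - ((i : ℕ) + 1) + 1 : ℕ) = 2 * N - i by omega, Nat.cast_sub i.2.le]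
    push_cast; ring
  rw [Finset.sum_neg_distrib] at h
  linarith

/-- The integral over a period of the product of the transforms of the steps. -/
noncomputable def contour (σ α : ℝ) (N : ℕ) (z : Fin (2 * N) → ℂ) : ℂ :=
  ∫ t in (-(Real.pi / 2))..(Real.pi / 2), ∏ i, stepTransform (stepTilt σ α N i) (z i + Complex.I * t)

lemma pi_mul_sum_weight_mul_exp (σ α : ℝ) {N : ℕ} (z : Fin (2 * N) → ℂ) :
    (Real.pi : ℂ) * ∑ S : Bridge N, (weight σ α S : ℂ) *
        Complex.exp (∑ i, z i * ((step S i - Real.tanh (stepTilt σ α N i) : ℝ) : ℂ)) =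
      (∏ i, (2 * Real.cosh (stepTilt σ α N i) : ℂ)) * contour σ α N z := by
  have h1 : ∀ S : Bridge N, (weight σ α S : ℂ) *
      Complex.exp (∑ i, z i * ((step S i - Real.tanh (stepTilt σ α N i) : ℝ) : ℂ)) =
      Complex.exp (-∑ i, z i * (Real.tanh (stepTilt σ α N i) : ℂ)) *
        Complex.exp (∑ i, (stepTilt σ α N i + z i) * (step S i : ℂ)) := by
    intro S
    rw [weight_eq, Complex.ofReal_exp, ← Complex.exp_add, ← Complex.exp_add]
    congr 1
    rw [← Finset.sum_neg_distrib, ← Finset.sum_add_distrib, Complex.ofReal_sum,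
      ← Finset.sum_add_distrib]
    exact Finset.sum_congr rfl fun i _ => by push_cast; ring
  simp_rw [h1, ← Finset.mul_sum]
  rw [mul_left_comm, sum_bridge_exp, contour, ← intervalIntegral.integral_const_mul,
    ← intervalIntegral.integral_const_mul]
  congr 1
  funext t
  rw [← Finset.sum_neg_distrib, Complex.exp_sum, ← Finset.prod_mul_distrib,
    ← Finset.prod_mul_distrib]
  -- The means sum to `0`, so centring the steps in the Fourier variable `t` costs nothing. This
  -- product is inserted to recover the centred transforms.
  have h2 : ∏ i, Complex.exp (Complex.I * t * (Real.tanh (stepTilt σ α N i) : ℂ)) = 1 := by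
    rw [← Complex.exp_sum, ← Finset.mul_sum, ← Complex.ofReal_sum, sum_tanh_stepTilt]
    simp
  rw [← mul_one (∏ i, (2 * (Real.cosh (stepTilt σ α N i) : ℂ) * _)), ← h2,
    ← Finset.prod_mul_distrib]
  refine Finset.prod_congr rfl fun i _ => ?_
  have hc : (Real.cosh (stepTilt σ α N i) : ℂ) ≠ 0 := by exact_mod_cast (Real.cosh_pos _).ne'
  unfold stepTransform
  rw [add_mul, neg_add, Complex.exp_add, Complex.exp_neg (Complex.I * t * _), add_assoc]
  have := Complex.exp_ne_zero (Complex.I * t * (Real.tanh (stepTilt σ α N i) : ℂ))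
  field_simp

/-- The exponential moments of the centred steps of the bridge, as a ratio of integrals. -/
theorem integral_exp_bridge (σ α : ℝ) {N : ℕ} (z : Fin (2 * N) → ℂ) :
    ∫ S, Complex.exp (∑ i, z i * ((step S i - Real.tanh (stepTilt σ α N i) : ℝ) : ℂ))
      ∂(invMeasure σ α N) = contour σ α N z / contour σ α N 0 := by
  have hz := pi_mul_sum_weight_mul_exp σ α z
  have h0 := pi_mul_sum_weight_mul_exp σ α (N := N) 0
  have hpi : (Real.pi : ℂ) ≠ 0 := by exact_mod_cast Real.pi_ne_zero
  have hZ : (partitionFn σ α N : ℂ) ≠ 0 := by exact_mod_cast (partitionFn_pos σ α N).ne'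
  have hP : (∏ i, (2 * Real.cosh (stepTilt σ α N i) : ℂ)) ≠ 0 :=
    Finset.prod_ne_zero_iff.2 fun i _ =>
      mul_ne_zero two_ne_zero (by exact_mod_cast (Real.cosh_pos _).ne')
  have e0 : ∑ S : Bridge N, (weight σ α S : ℂ) *
      Complex.exp (∑ i, (0 : Fin (2 * N) → ℂ) i *
        ((step S i - Real.tanh (stepTilt σ α N i) : ℝ) : ℂ)) = partitionFn σ α N := by
    simp [partitionFn]
  rw [e0] at h0
  rw [integral_invMeasure]
  have e1 : ∑ S : Bridge N, (weight σ α S / partitionFn σ α N) •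
      Complex.exp (∑ i, z i * ((step S i - Real.tanh (stepTilt σ α N i) : ℝ) : ℂ)) =
      (∑ S : Bridge N, (weight σ α S : ℂ) *
        Complex.exp (∑ i, z i * ((step S i - Real.tanh (stepTilt σ α N i) : ℝ) : ℂ))) /
      partitionFn σ α N := by
    rw [Finset.sum_div]
    refine Finset.sum_congr rfl fun S _ => ?_
    rw [Complex.real_smul]; push_cast; ring
  rw [e1]
  -- Up to nonzero factors this is the partition function.
  have hc : contour σ α N 0 ≠ 0 := by
    intro h
    rw [h, mul_zero] at h0
    exact (mul_ne_zero hpi hZ) h0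
  rw [div_eq_div_iff hZ hc]
  apply mul_left_cancel₀ (mul_ne_zero hP hpi)
  linear_combination (∏ i, (2 * Real.cosh (stepTilt σ α N i) : ℂ)) * contour σ α N 0 * hz -
    (∏ i, (2 * Real.cosh (stepTilt σ α N i) : ℂ)) * contour σ α N z * h0

/-! ### The interpolated height as a weighted sum of steps -/

/-- The weight of the step from `i` to `i + 1` in the interpolated path at `t`. -/
noncomputable def clip (i : ℕ) (t : ℝ) : ℝ := max 0 (min 1 (t - i))

lemma clip_nonneg (i : ℕ) (t : ℝ) : 0 ≤ clip i t := le_max_left _ _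

lemma clip_le_one (i : ℕ) (t : ℝ) : clip i t ≤ 1 := max_le zero_le_one (min_le_left _ _)

lemma clip_mono (i : ℕ) : Monotone (clip i) := fun s t h => by
  unfold clip; gcongr

lemma clip_of_le {i : ℕ} {t : ℝ} (h : (i : ℝ) + 1 ≤ t) : clip i t = 1 := by
  unfold clip
  rw [min_eq_left (by linarith), max_eq_right zero_le_one]

lemma clip_of_ge {i : ℕ} {t : ℝ} (h : t ≤ i) : clip i t = 0 := by
  unfold clip
  rw [max_eq_left ((min_le_right _ _).trans (by linarith))]

lemma height_succ_sub {N : ℕ} (S : Bridge N) (i : Fin (2 * N)) :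
    height S ((i : ℕ) + 1) - height S i = step S i := by
  unfold height
  rw [← Finset.sum_sub_distrib, Finset.sum_eq_single i]
  · simp [step]
  · intro j _ hj
    have : (j : ℕ) ≠ i := fun h => hj (Fin.ext h)
    by_cases h : (j : ℕ) < i
    · simp [h, h.trans (Nat.lt_succ_self _)]
    · have : ¬ (j : ℕ) < i + 1 := by omega
      simp [h, this]
  · simp

lemma centring_succ_sub (σ α : ℝ) (N k : ℕ) :
    centring σ α N (k + 1) - centring σ α N k = Real.tanh (tilt σ α N (k + 1)) := by
  unfold centring
  rw [Finset.sum_Icc_succ_top (by omega), deriv_logCosh]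
  ring

/-- Both interpolations use the same weights, so values and increments of the path are linear
statistics of the centred steps, to which `integral_exp_bridge` applies. -/
lemma centredHeight_eq (σ α : ℝ) {N : ℕ} (S : Bridge N) (t : ℝ) :
    centredHeight σ α S t =
      ∑ i : Fin (2 * N), clip i t * (step S i - Real.tanh (stepTilt σ α N i)) := by
  unfold centredHeight interp
  have h0 : height S 0 = 0 := by simp [height]
  have h1 : centring σ α N 0 = 0 := by simp [centring]
  rw [h0, h1, zero_add, zero_add, ← Finset.sum_sub_distrib, Finset.sum_range]
  refine Finset.sum_congr rfl fun i _ => ?_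
  rw [← sub_mul, height_succ_sub, centring_succ_sub, mul_comm]
  rfl

end WeaklyAsymmetricBridge

namespace WeaklyAsymmetricBridge
open scoped Topology

/-! ### The local limit theorem -/

/-- The variance of the sum of the independent tilted steps. -/
noncomputable def totalVariance (σ α : ℝ) (N : ℕ) : ℝ := ∑ i, sechSq (stepTilt σ α N i)

/-- From `|sin x| ≤ |sin (x + y)| + |y|`, squared. It separates the integration variable from the
bounded perturbation of the phase. -/
lemma sin_sq_add_ge (x y : ℝ) : Real.sin x ^ 2 / 2 - y ^ 2 ≤ Real.sin (x + y) ^ 2 := by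
  have h1 : |Real.sin x| ≤ |Real.sin (x + y)| + |y| := by
    have : Real.sin x = Real.sin (x + y) * Real.cos y - Real.cos (x + y) * Real.sin y := by
      rw [← Real.sin_sub]; congr 1; ring
    rw [this]
    refine (abs_sub _ _).trans (add_le_add ?_ ?_)
    · rw [abs_mul]
      exact mul_le_of_le_one_right (abs_nonneg _) (Real.abs_cos_le_one y)
    · rw [abs_mul]
      exact (mul_le_of_le_one_left (abs_nonneg _) (Real.abs_cos_le_one _)).trans
        (Real.abs_sin_le_abs)
  rw [← sq_abs (Real.sin x), ← sq_abs y, ← sq_abs (Real.sin (x + y))]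
  nlinarith [abs_nonneg (Real.sin x), abs_nonneg y, abs_nonneg (Real.sin (x + y)),
    sq_nonneg (|Real.sin (x + y)| - |y|)]

lemma sin_sq_ge {x : ℝ} (hx : |x| ≤ Real.pi / 2) :
    (2 / Real.pi) ^ 2 * x ^ 2 ≤ Real.sin x ^ 2 := by
  have h := Real.mul_le_sin (abs_nonneg x) hx
  have hs : Real.sin |x| ^ 2 = Real.sin x ^ 2 := by
    rcases abs_choice x with h | h <;> rw [h]
    rw [Real.sin_neg]; ring
  rw [← hs, ← sq_abs x, ← mul_pow]
  exact pow_le_pow_left₀ (mul_nonneg (by positivity) (abs_nonneg x)) h 2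

/-- The substitution `t = s / r`, written as an integral over the whole line so that dominated
convergence applies; `r` will be `√(a N)`. -/
lemma sqrt_mul_contour (σ α : ℝ) (N : ℕ) {r : ℝ} (hr : 0 < r) (z : Fin (2 * N) → ℂ) :
    (r : ℂ) * contour σ α N z = ∫ s : ℝ, (Set.Ioc (-(Real.pi / 2 * r)) (Real.pi / 2 * r)).indicator
      (fun s : ℝ => ∏ i, stepTransform (stepTilt σ α N i) (z i + Complex.I * (s / r : ℝ))) s := by
  rw [integral_indicator measurableSet_Ioc, ← intervalIntegral.integral_of_le (by
    have := Real.pi_pos; nlinarith [mul_pos (half_pos this) hr])]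
  have := intervalIntegral.integral_comp_div (a := -(Real.pi / 2 * r)) (b := Real.pi / 2 * r)
    (fun t : ℝ => ∏ i, stepTransform (stepTilt σ α N i) (z i + Complex.I * t)) hr.ne'
  rw [this, contour, Complex.real_smul]
  rw [neg_div, mul_div_cancel_right₀ _ hr.ne']

lemma integral_exp_neg_quadratic {Q : ℝ} (hQ : 0 < Q) (m₁ m₂ : ℝ) :
    ∫ s : ℝ, Real.exp (-(m₂ + 2 * m₁ * s + Q * s ^ 2) / 2) =
      Real.exp (-(m₂ - m₁ ^ 2 / Q) / 2) * √(Real.pi / (Q / 2)) := by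
  have : ∀ s : ℝ, Real.exp (-(m₂ + 2 * m₁ * s + Q * s ^ 2) / 2) =
      Real.exp (-(m₂ - m₁ ^ 2 / Q) / 2) * Real.exp (-(Q / 2) * (s + m₁ / Q) ^ 2) := by
    intro s
    rw [← Real.exp_add]; congr 1; field_simp; ring
  simp_rw [this]
  rw [integral_const_mul, integral_add_right_eq_self (fun s : ℝ => Real.exp (-(Q / 2) * s ^ 2)),
    integral_gaussian]

section LocalLimit

variable {σ α : ℝ} {a : ℕ → ℝ} {β : (N : ℕ) → Fin (2 * N) → ℝ} {Θ Q m₁ m₂ : ℝ}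

/-- The Gaussian domination for the local limit theorem: each factor decays in proportion to its own
variance, so only the total variance enters. -/
lemma norm_prod_stepTransform_le (N : ℕ) {r : ℝ} (hr : 0 < r) (b : Fin (2 * N) → ℝ)
    (hb : ∀ i, |b i| ≤ Θ) {s : ℝ} (hs : |s| ≤ Real.pi / 2 * r) :
    ‖∏ i, stepTransform (stepTilt σ α N i)
      (Complex.I * (b i / r : ℝ) + Complex.I * (s / r : ℝ))‖ ≤
      Real.exp (-(totalVariance σ α N / r ^ 2 * (2 / Real.pi ^ 2 * s ^ 2 - Θ ^ 2)) / 16) := by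
  rw [norm_prod, totalVariance, Finset.sum_div, Finset.sum_mul, ← Finset.sum_neg_distrib,
    Finset.sum_div, Real.exp_sum]
  refine Finset.prod_le_prod (fun i _ => norm_nonneg _) fun i _ => ?_
  rw [← mul_add, ← Complex.ofReal_add]
  refine (norm_stepTransform_I_le _ _).trans (Real.exp_le_exp.2 ?_)
  have h1 := sin_sq_add_ge (s / r) (b i / r)
  have h2 : |s / r| ≤ Real.pi / 2 := by
    rw [abs_div, abs_of_pos hr, div_le_iff₀ hr]; exact hs
  have h3 := sin_sq_ge h2
  have h4 : (b i / r) ^ 2 ≤ Θ ^ 2 / r ^ 2 := by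
    rw [div_pow]
    have : b i ^ 2 ≤ Θ ^ 2 := by rw [← sq_abs]; exact pow_le_pow_left₀ (abs_nonneg _) (hb i) 2
    gcongr
  have h5 : (2 / Real.pi ^ 2 * s ^ 2 - Θ ^ 2) / r ^ 2 ≤ Real.sin (b i / r + s / r) ^ 2 := by
    rw [add_comm]
    refine le_trans ?_ h1
    have : (2 / Real.pi ^ 2 * s ^ 2 - Θ ^ 2) / r ^ 2 =
      (2 / Real.pi) ^ 2 * (s / r) ^ 2 / 2 - Θ ^ 2 / r ^ 2 := by
      have := Real.pi_ne_zero; field_simp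
    rw [this]; linarith
  have h6 := mul_le_mul_of_nonneg_left h5 (sechSq_pos (stepTilt σ α N i)).le
  have h7 : sechSq (stepTilt σ α N i) / r ^ 2 * (2 / Real.pi ^ 2 * s ^ 2 - Θ ^ 2) =
    sechSq (stepTilt σ α N i) * ((2 / Real.pi ^ 2 * s ^ 2 - Θ ^ 2) / r ^ 2) := by ring
  rw [h7]; linarith

/-- Each factor is replaced by the Gaussian transform with the same variance. The exponents then add
up exactly to the given sums, and the total error is at most `(V/a) R³/√a`, with `V` the total
variance. -/
lemma tendsto_prod_stepTransform (ha : Tendsto a atTop atTop) (hβ : ∀ N i, |β N i| ≤ Θ)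
    (hV : Tendsto (fun N => totalVariance σ α N / a N) atTop (𝓝 Q))
    (h1 : Tendsto (fun N => (∑ i, sechSq (stepTilt σ α N i) * β N i) / a N) atTop (𝓝 m₁))
    (h2 : Tendsto (fun N => (∑ i, sechSq (stepTilt σ α N i) * β N i ^ 2) / a N) atTop (𝓝 m₂))
    (s : ℝ) :
    Tendsto (fun N => ∏ i, stepTransform (stepTilt σ α N i)
      (Complex.I * (β N i / √(a N) : ℝ) + Complex.I * (s / √(a N) : ℝ))) atTop
      (𝓝 ((Real.exp (-(m₂ + 2 * m₁ * s + Q * s ^ 2) / 2) : ℝ) : ℂ)) := by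
  have hr : Tendsto (fun N => √(a N)) atTop atTop := Real.tendsto_sqrt_atTop.comp ha
  set R := |s| + Θ
  have hexp : Tendsto (fun N => ∏ i, ((Real.exp (-(sechSq (stepTilt σ α N i) *
      ((β N i + s) / √(a N)) ^ 2 / 2)) : ℝ) : ℂ)) atTop
      (𝓝 ((Real.exp (-(m₂ + 2 * m₁ * s + Q * s ^ 2) / 2) : ℝ) : ℂ)) := by
    have h3 := ((h2.add (h1.const_mul (2 * s))).add (hV.const_mul (s ^ 2))).neg.div_const 2
    have h4 : Tendsto (fun N => Real.exp (∑ i, -(sechSq (stepTilt σ α N i) *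
        ((β N i + s) / √(a N)) ^ 2 / 2))) atTop
        (𝓝 (Real.exp (-(m₂ + 2 * m₁ * s + Q * s ^ 2) / 2))) := by
      refine (Real.continuous_exp.tendsto _).comp ?_
      refine (h3.congr' ?_).trans (by rw [show m₂ + 2 * s * m₁ + s ^ 2 * Q =
        m₂ + 2 * m₁ * s + Q * s ^ 2 by ring])
      filter_upwards [ha.eventually_gt_atTop 0] with N hN
      have : ∀ i, -(sechSq (stepTilt σ α N i) * ((β N i + s) / √(a N)) ^ 2 / 2) =
          -(sechSq (stepTilt σ α N i) * β N i ^ 2 / a N + 2 * s *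
            (sechSq (stepTilt σ α N i) * β N i / a N) +
            s ^ 2 * (sechSq (stepTilt σ α N i) / a N)) / 2 := by
        intro i
        rw [div_pow, Real.sq_sqrt hN.le]; ring
      simp_rw [this]
      rw [← Finset.sum_div, Finset.sum_neg_distrib, Finset.sum_add_distrib, Finset.sum_add_distrib,
        ← Finset.mul_sum, ← Finset.mul_sum, ← Finset.sum_div, ← Finset.sum_div, ← Finset.sum_div,
        totalVariance]
    refine ((Complex.continuous_ofReal.tendsto _).comp h4).congr fun N => ?_
    rw [Function.comp_apply, Real.exp_sum, Complex.ofReal_prod]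
  refine tendsto_of_tendsto_of_dist hexp ?_
  have hz : Tendsto (fun N => totalVariance σ α N / a N * (R ^ 3 / √(a N))) atTop (𝓝 0) := by
    simpa using hV.mul (hr.const_div_atTop (R ^ 3))
  refine squeeze_zero' (Eventually.of_forall fun N => dist_nonneg) ?_ hz
  filter_upwards [ha.eventually_gt_atTop 0, hr.eventually_ge_atTop (2 * R),
    hr.eventually_gt_atTop 0] with N hN hN2 hr0
  rw [dist_comm, dist_eq_norm]
  have hu : ∀ i, |(β N i + s) / √(a N)| ≤ R / √(a N) := by
    intro i
    rw [abs_div, abs_of_pos hr0]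
    gcongr
    refine (abs_add_le _ _).trans ?_
    have := hβ N i
    simp only [R]; linarith
  have hu2 : R / √(a N) ≤ 1 / 2 := by rw [div_le_iff₀ hr0]; linarith
  refine (norm_prod_sub_prod_le _ _ _ (fun i _ => ?_) (fun i _ => ?_)).trans ?_
  · rw [← mul_add, ← Complex.ofReal_add]; exact norm_stepTransform_I_le_one _ _
  · rw [Complex.norm_real, Real.norm_eq_abs, abs_of_pos (Real.exp_pos _), Real.exp_le_one_iff]
    have := sechSq_pos (stepTilt σ α N i)
    simp only [Left.neg_nonpos_iff]; positivity
  · calc _ ≤ ∑ i, sechSq (stepTilt σ α N i) * (R / √(a N)) ^ 3 := by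
          refine Finset.sum_le_sum fun i _ => ?_
          rw [← mul_add, ← Complex.ofReal_add, ← add_div]
          refine (norm_stepTransform_sub_exp_le _ _ ((hu i).trans hu2)).trans ?_
          have := (sechSq_pos (stepTilt σ α N i)).le
          gcongr
          exact hu i
      _ = _ := by
          rw [← Finset.sum_mul, totalVariance, div_pow]
          have h3 : √(a N) ^ 3 = a N * √(a N) := by
            rw [pow_succ, Real.sq_sqrt hN.le]
          rw [h3]
          field_simp

/-- The local limit theorem for the tilted steps. -/
theorem tendsto_contour (ha : Tendsto a atTop atTop) (hβ : ∀ N i, |β N i| ≤ Θ) (hQ : 0 < Q)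
    (hV : Tendsto (fun N => totalVariance σ α N / a N) atTop (𝓝 Q))
    (h1 : Tendsto (fun N => (∑ i, sechSq (stepTilt σ α N i) * β N i) / a N) atTop (𝓝 m₁))
    (h2 : Tendsto (fun N => (∑ i, sechSq (stepTilt σ α N i) * β N i ^ 2) / a N) atTop (𝓝 m₂)) :
    Tendsto (fun N => (√(a N) : ℂ) *
        contour σ α N (fun i => Complex.I * (β N i / √(a N) : ℝ))) atTop
      (𝓝 ((Real.exp (-(m₂ - m₁ ^ 2 / Q) / 2) * √(Real.pi / (Q / 2)) : ℝ) : ℂ)) := by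
  have hr : Tendsto (fun N => √(a N)) atTop atTop := Real.tendsto_sqrt_atTop.comp ha
  rw [← integral_exp_neg_quadratic hQ, ← integral_complex_ofReal]
  have hpi := Real.pi_pos
  -- For large `N` the ratio `V/a` lies between `Q/2` and `2Q`. The lower bound is used on the term
  -- in `s²`, the upper bound on the term in `Θ²`.
  let bound : ℝ → ℝ := fun s => Real.exp (Q * Θ ^ 2 / 8) *
    Real.exp (-(Q / (16 * Real.pi ^ 2)) * s ^ 2)
  have key : Tendsto (fun N => ∫ s : ℝ,
      (Set.Ioc (-(Real.pi / 2 * √(a N))) (Real.pi / 2 * √(a N))).indicator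
      (fun s : ℝ => ∏ i, stepTransform (stepTilt σ α N i)
        (Complex.I * (β N i / √(a N) : ℝ) + Complex.I * (s / √(a N) : ℝ))) s) atTop
      (𝓝 (∫ s : ℝ, ((Real.exp (-(m₂ + 2 * m₁ * s + Q * s ^ 2) / 2) : ℝ) : ℂ))) := by
    refine tendsto_integral_filter_of_dominated_convergence bound ?_ ?_ ?_ ?_
    · refine Eventually.of_forall fun N => ?_
      refine (Continuous.aestronglyMeasurable ?_).indicator measurableSet_Ioc
      have := fun i => continuous_stepTransform (stepTilt σ α N i)
      fun_prop
    · filter_upwards [ha.eventually_gt_atTop 0, hr.eventually_gt_atTop 0,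
        hV.eventually_const_le (show Q / 2 < Q by linarith),
        hV.eventually_le_const (show Q < 2 * Q by linarith)] with N hN hr0 hV1 hV2
      refine Eventually.of_forall fun s => ?_
      by_cases hs : s ∈ Set.Ioc (-(Real.pi / 2 * √(a N))) (Real.pi / 2 * √(a N))
      · rw [Set.indicator_of_mem hs]
        refine (norm_prod_stepTransform_le N hr0 (β N) (hβ N)
          (abs_le.2 ⟨hs.1.le, hs.2⟩)).trans ?_
        simp only [bound]
        rw [← Real.exp_add, Real.exp_le_exp, Real.sq_sqrt hN.le]
        have e1 : Q / 2 * (2 / Real.pi ^ 2 * s ^ 2) ≤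
            totalVariance σ α N / a N * (2 / Real.pi ^ 2 * s ^ 2) :=
          mul_le_mul_of_nonneg_right hV1 (by positivity)
        have e2 : totalVariance σ α N / a N * Θ ^ 2 ≤ 2 * Q * Θ ^ 2 :=
          mul_le_mul_of_nonneg_right hV2 (by positivity)
        have e3 : Q / (16 * Real.pi ^ 2) * s ^ 2 = Q / 2 * (2 / Real.pi ^ 2 * s ^ 2) / 16 := by
          field_simp
        rw [neg_mul, e3]
        linarith
      · rw [Set.indicator_of_notMem hs, norm_zero]
        positivity
    · exact (integrable_exp_neg_mul_sq (by positivity)).const_mul _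
    · refine Eventually.of_forall fun s => ?_
      refine (tendsto_prod_stepTransform ha hβ hV h1 h2 s).congr' ?_
      filter_upwards [hr.eventually_gt_atTop (|s| / (Real.pi / 2))] with N hN
      rw [div_lt_iff₀ (by positivity)] at hN
      rw [Set.indicator_of_mem]
      have := abs_lt.1 hN
      rw [mul_comm] at this
      exact ⟨this.1, this.2.le⟩
  refine key.congr' ?_
  filter_upwards [hr.eventually_gt_atTop 0] with N hr0
  rw [sqrt_mul_contour σ α N hr0]

lemma tendsto_contour_zero (ha : Tendsto a atTop atTop) (hQ : 0 < Q)
    (hV : Tendsto (fun N => totalVariance σ α N / a N) atTop (𝓝 Q)) :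
    Tendsto (fun N => (√(a N) : ℂ) * contour σ α N 0) atTop
      (𝓝 ((√(Real.pi / (Q / 2)) : ℝ) : ℂ)) := by
  have := tendsto_contour (σ := σ) (α := α) (β := fun _ _ => 0) (Θ := 0) (m₁ := 0) (m₂ := 0) ha
    (by simp) hQ hV (by simp) (by simp)
  simpa [Pi.zero_def] using this

/-- Convergence of the characteristic functions of linear statistics of the bridge. -/
theorem tendsto_integral_exp_bridge (ha : Tendsto a atTop atTop) (hβ : ∀ N i, |β N i| ≤ Θ)
    (hQ : 0 < Q) (hV : Tendsto (fun N => totalVariance σ α N / a N) atTop (𝓝 Q))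
    (h1 : Tendsto (fun N => (∑ i, sechSq (stepTilt σ α N i) * β N i) / a N) atTop (𝓝 m₁))
    (h2 : Tendsto (fun N => (∑ i, sechSq (stepTilt σ α N i) * β N i ^ 2) / a N) atTop (𝓝 m₂)) :
    Tendsto (fun N => ∫ S, Complex.exp (∑ i, Complex.I * (β N i / √(a N) : ℝ) *
        ((step S i - Real.tanh (stepTilt σ α N i) : ℝ) : ℂ)) ∂(invMeasure σ α N)) atTop
      (𝓝 ((Real.exp (-(m₂ - m₁ ^ 2 / Q) / 2) : ℝ) : ℂ)) := by
  have hr : Tendsto (fun N => √(a N)) atTop atTop := Real.tendsto_sqrt_atTop.comp ha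
  have hG : 0 < √(Real.pi / (Q / 2)) := Real.sqrt_pos.2 (by have := Real.pi_pos; positivity)
  have hG' : ((√(Real.pi / (Q / 2)) : ℝ) : ℂ) ≠ 0 := by exact_mod_cast hG.ne'
  have := (tendsto_contour ha hβ hQ hV h1 h2).div (tendsto_contour_zero ha hQ hV) hG'
  rw [Complex.ofReal_mul, mul_div_cancel_right₀ _ hG'] at this
  refine this.congr' ?_
  filter_upwards [hr.eventually_gt_atTop 0] with N hr0
  rw [integral_exp_bridge, Pi.div_apply, mul_div_mul_left _ _ (by exact_mod_cast hr0.ne')]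

/-! ### The moment bound -/

/-- The numerator of real exponential moments: Hoeffding's factors come out of the integral, and the
remaining decay is Gaussian. -/
lemma norm_contour_real_le (N : ℕ) {r : ℝ} (hr : 0 < r) (l : Fin (2 * N) → ℝ)
    (hl : ∀ i, |l i| ≤ 1) (hV : 0 < totalVariance σ α N) :
    ‖(r : ℂ) * contour σ α N (fun i => (l i : ℂ))‖ ≤ Real.exp (∑ i, l i ^ 2 / 2) *
      √(Real.pi / (totalVariance σ α N / r ^ 2 / (4 * Real.pi ^ 2))) := by
  rw [sqrt_mul_contour σ α N hr, ← integral_gaussian, ← integral_const_mul]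
  have hpi := Real.pi_pos
  refine norm_integral_le_of_norm_le
    ((integrable_exp_neg_mul_sq (by positivity)).const_mul _) (Eventually.of_forall fun s => ?_)
  by_cases hs : s ∈ Set.Ioc (-(Real.pi / 2 * r)) (Real.pi / 2 * r)
  · rw [Set.indicator_of_mem hs, norm_prod]
    have h2 : |s / r| ≤ Real.pi / 2 := by
      rw [abs_div, abs_of_pos hr, div_le_iff₀ hr]; exact abs_le.2 ⟨hs.1.le, hs.2⟩
    have h3 := sin_sq_ge h2
    refine (Finset.prod_le_prod (fun i _ => norm_nonneg _) fun i _ =>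
      norm_stepTransform_le _ (l i) (s / r) (hl i)).trans ?_
    rw [Finset.prod_mul_distrib, ← Real.exp_sum, ← Real.exp_sum]
    gcongr
    rw [Finset.sum_neg_distrib, ← Finset.sum_div, ← Finset.sum_mul, ← totalVariance, neg_mul,
      neg_le_neg_iff]
    have h4 := mul_le_mul_of_nonneg_left h3 hV.le
    have h5 : totalVariance σ α N / r ^ 2 / (4 * Real.pi ^ 2) * s ^ 2 =
        totalVariance σ α N * ((2 / Real.pi) ^ 2 * (s / r) ^ 2) / 16 := by
      field_simp; ring
    rw [h5]; linarith
  · rw [Set.indicator_of_notMem hs, norm_zero]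
    positivity

/-- Here `48 = 2 * 4!`, from `exp |x| ≥ x⁴ / 4!` and `cosh x ≥ exp |x| / 2`. -/
lemma pow_four_le_cosh (x : ℝ) : x ^ 4 ≤ 48 * Real.cosh x := by
  have h1 := Real.pow_div_factorial_le_exp |x| (abs_nonneg x) 4
  rw [← Real.cosh_abs, Real.cosh_eq]
  have h2 : x ^ 4 = |x| ^ 4 := by rw [pow_abs, abs_of_nonneg (by positivity)]
  rw [h2]
  have h3 := Real.exp_pos (-|x|)
  norm_num [Nat.factorial] at h1
  linarith

lemma sum_clip (n : ℕ) (t : ℝ) : ∑ i ∈ Finset.range n, clip i t = max 0 (min (n : ℝ) t) := by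
  induction n with
  | zero => simp
  | succ n ih =>
    have hn : (0 : ℝ) ≤ n := n.cast_nonneg
    rw [Finset.sum_range_succ, ih, clip]
    push_cast
    rcases le_total t n with h | h
    · rw [min_eq_right h, min_eq_right (by linarith : t - n ≤ 1),
        min_eq_right (by linarith : t ≤ n + 1), max_eq_left (by linarith : t - n ≤ 0), add_zero]
    · rw [min_eq_left h, max_eq_right hn]
      rcases le_total t (n + 1) with h' | h'
      · rw [min_eq_right (by linarith : t - n ≤ 1), max_eq_right (by linarith), min_eq_right h',
          max_eq_right (by linarith)]
        ring
      · rw [min_eq_left (by linarith : 1 ≤ t - n), max_eq_right zero_le_one, min_eq_left h',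
          max_eq_right (by linarith)]

/-- The weights are monotone in `t`, and their sum is the truncation of `t` to `[0, n]`, which is
1-Lipschitz. -/
lemma sum_abs_clip_sub_le (n : ℕ) (s t : ℝ) :
    ∑ i : Fin n, |clip i t - clip i s| ≤ |t - s| := by
  wlog h : s ≤ t generalizing s t
  · rw [abs_sub_comm t s]
    simp_rw [abs_sub_comm (clip _ t)]
    exact this t s (le_of_not_ge h)
  rw [← Finset.sum_range (fun i => |clip i t - clip i s|)]
  have : ∀ i, |clip i t - clip i s| = clip i t - clip i s := fun i =>
    abs_of_nonneg (sub_nonneg.2 (clip_mono i h))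
  simp_rw [this]
  rw [Finset.sum_sub_distrib, sum_clip, sum_clip]
  rw [abs_of_nonneg (sub_nonneg.2 h)]
  have h1 : min (n : ℝ) t ≤ min (n : ℝ) s + (t - s) := by
    rw [← min_add_add_right]; exact min_le_min (by linarith) (by linarith)
  have h2 : max 0 (min (n : ℝ) t) ≤ max 0 (min (n : ℝ) s) + (t - s) := by
    rw [← max_add_add_right]; exact max_le_max (by linarith) h1
  linarith

/-- The constant in the moment bound. -/
noncomputable def momentConst (Q : ℝ) : ℝ :=
  -- The quotient bounds an exponential moment: the numerator is the bound of `norm_contour_real_le`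
  -- with `V/a ≥ Q/2` and squares summing to at most `1`, the denominator half the limit of the
  -- rescaled contour integral at `0`. The `48` is that of `pow_four_le_cosh`.
  48 * (Real.exp (1 / 2) * √(Real.pi / (Q / 2 / (4 * Real.pi ^ 2))) /
    (√(Real.pi / (Q / 2)) / 2))

/-- Fourth moments of the increments of the interpolated centred height. -/
theorem eventually_integral_centredHeight_sub_le (ha : Tendsto a atTop atTop) (hQ : 0 < Q)
    (hV : Tendsto (fun N => totalVariance σ α N / a N) atTop (𝓝 Q)) :
    ∀ᶠ N in atTop, ∀ s t : ℝ, ∫ S : Bridge N, (centredHeight σ α S t - centredHeight σ α S s) ^ 4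
      ∂(invMeasure σ α N) ≤ momentConst Q * (t - s) ^ 2 := by
  have hr : Tendsto (fun N => √(a N)) atTop atTop := Real.tendsto_sqrt_atTop.comp ha
  have hpi := Real.pi_pos
  have hG : 0 < √(Real.pi / (Q / 2)) := Real.sqrt_pos.2 (by positivity)
  have hlow := (tendsto_contour_zero ha hQ hV).norm
  rw [Complex.norm_real, Real.norm_eq_abs, abs_of_pos hG] at hlow
  filter_upwards [ha.eventually_gt_atTop 0, hr.eventually_gt_atTop 0,
    hV.eventually_const_le (show Q / 2 < Q by linarith),
    hlow.eventually_const_le (half_lt_self hG)] with N hN hr0 hV1 hlow s t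
  rcases eq_or_ne t s with rfl | hne
  · simp
  set d := |t - s| with hd
  have hd0 : 0 < d := abs_pos.2 (sub_ne_zero.2 hne)
  set w : Fin (2 * N) → ℝ := fun i => clip i t - clip i s with hw
  have hw1 : ∀ i, |w i| ≤ 1 := fun i => by
    have := clip_nonneg i t; have := clip_nonneg i s
    have := clip_le_one i t; have := clip_le_one i s
    rw [abs_le]; constructor <;> simp only [hw] <;> linarith
  have hwd : ∑ i, |w i| ≤ d := sum_abs_clip_sub_le _ s t
  have hwd' : ∀ i, |w i| ≤ d := fun i =>
    (Finset.single_le_sum (f := fun i => |w i|) (fun i _ => abs_nonneg _)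
      (Finset.mem_univ i)).trans hwd
  have hw2 : ∀ i, w i ^ 2 ≤ |w i| := fun i => by
    rw [← sq_abs]; nlinarith [abs_nonneg (w i), hw1 i]
  have hVpos : 0 < totalVariance σ α N := by
    have : 0 < totalVariance σ α N / a N := by linarith
    exact (div_pos_iff_of_pos_right hN).1 this
  -- The arguments are `± w i / √d`. As `|w i| ≤ 1` and `∑ |w i| ≤ d`, their squares sum to at most
  -- `1` and each is at most `1`. This holds for every `d > 0`, even below the lattice spacing, so
  -- the chaining needs no cutoff.
  have bd : ∀ e : ℝ, e ^ 2 = 1 → ∫ S : Bridge N,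
      Real.exp (e / √d * (centredHeight σ α S t - centredHeight σ α S s)) ∂(invMeasure σ α N) ≤
      momentConst Q / 48 := by
    intro e he
    have hsd : 0 < √d := Real.sqrt_pos.2 hd0
    have hl2 : ∀ i, (e / √d * w i) ^ 2 = w i ^ 2 / d := fun i => by
      rw [mul_pow, div_pow, he, Real.sq_sqrt hd0.le]; ring
    have hl1 : ∀ i, |e / √d * w i| ≤ 1 := fun i => by
      rw [← sq_le_one_iff_abs_le_one, hl2, div_le_one hd0]
      exact (hw2 i).trans (hwd' i)
    have h1 := norm_contour_real_le N hr0 (fun i => e / √d * w i) hl1 hVpos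
    rw [Real.sq_sqrt hN.le] at h1
    have h2 : ∑ i, (e / √d * w i) ^ 2 / 2 ≤ 1 / 2 := by
      simp_rw [hl2]
      rw [← Finset.sum_div, ← Finset.sum_div, div_le_div_iff_of_pos_right two_pos,
        div_le_one hd0]
      exact (Finset.sum_le_sum fun i _ => hw2 i).trans hwd
    have h3 := integral_exp_bridge σ α (N := N) (fun i => ((e / √d * w i : ℝ) : ℂ))
    have h4 : ∀ S : Bridge N, Complex.exp (∑ i, ((e / √d * w i : ℝ) : ℂ) *
        ((step S i - Real.tanh (stepTilt σ α N i) : ℝ) : ℂ)) =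
        ((Real.exp (e / √d * (centredHeight σ α S t - centredHeight σ α S s)) : ℝ) : ℂ) := by
      intro S
      rw [Complex.ofReal_exp, centredHeight_eq, centredHeight_eq, ← Finset.sum_sub_distrib,
        Finset.mul_sum, Complex.ofReal_sum]
      congr 1
      refine Finset.sum_congr rfl fun i _ => ?_
      rw [← Complex.ofReal_mul]
      congr 1
      simp only [hw]; ring
    simp_rw [h4] at h3
    rw [integral_complex_ofReal] at h3
    have h5 := congrArg norm h3
    rw [Complex.norm_real, Real.norm_eq_abs, norm_div] at h5
    have hrn : ‖((√(a N) : ℝ) : ℂ)‖ ≠ 0 := by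
      rw [Complex.norm_real, Real.norm_eq_abs, abs_of_pos hr0]; exact hr0.ne'
    rw [← mul_div_mul_left _ ‖contour σ α N 0‖ hrn, ← norm_mul, ← norm_mul] at h5
    refine (le_abs_self _).trans (h5.le.trans ?_)
    rw [momentConst, mul_div_cancel_left₀ _ (by norm_num)]
    apply div_le_div₀ (by positivity) (h1.trans _) (by positivity) hlow
    gcongr
  have hs : (√d) ^ 4 = d ^ 2 := by
    rw [show (4 : ℕ) = 2 * 2 by norm_num, pow_mul, Real.sq_sqrt hd0.le]
  have hsd : 0 < √d := Real.sqrt_pos.2 hd0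
  calc _ ≤ ∫ S : Bridge N, d ^ 2 * (24 *
        (Real.exp (1 / √d * (centredHeight σ α S t - centredHeight σ α S s)) +
          Real.exp (-1 / √d * (centredHeight σ α S t - centredHeight σ α S s))))
        ∂(invMeasure σ α N) := by
        refine integral_mono (integrable_invMeasure _ _ _) (integrable_invMeasure _ _ _) fun S => ?_
        have := pow_four_le_cosh (1 / √d * (centredHeight σ α S t - centredHeight σ α S s))
        rw [mul_pow, div_pow, hs, one_pow, Real.cosh_eq] at this
        rw [div_mul_eq_mul_div, one_mul, div_le_iff₀ (by positivity)] at this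
        refine this.trans (le_of_eq ?_)
        rw [show -(1 / √d * (centredHeight σ α S t - centredHeight σ α S s)) =
          -1 / √d * (centredHeight σ α S t - centredHeight σ α S s) by ring]
        ring
    _ = d ^ 2 * (24 * (∫ S : Bridge N,
        Real.exp (1 / √d * (centredHeight σ α S t - centredHeight σ α S s)) ∂(invMeasure σ α N) +
        ∫ S : Bridge N, Real.exp (-1 / √d * (centredHeight σ α S t - centredHeight σ α S s))
          ∂(invMeasure σ α N))) := by
        rw [integral_const_mul, integral_const_mul, integral_add (integrable_invMeasure _ _ _)
          (integrable_invMeasure _ _ _)]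
    _ ≤ d ^ 2 * (24 * (momentConst Q / 48 + momentConst Q / 48)) := by
        gcongr
        · exact bd 1 (by norm_num)
        · exact bd (-1) (by norm_num)
    _ = _ := by rw [hd, sq_abs]; ring

end LocalLimit

end WeaklyAsymmetricBridge

namespace WeaklyAsymmetricBridge
open scoped Topology ENNReal

/-! ### Tightness in the space of continuous functions on the line -/

/-- On `[-M, M]`, the increments of `u` over the dyadic intervals of length `2⁻ⁿ` are at most
`A θⁿ` for all `n`. -/
def DyadicBound (M : ℕ) (A θ : ℝ) (u : C(ℝ, ℝ)) : Prop :=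
  ∀ (n : ℕ) (k : ℤ), k ∈ Finset.Ico (-(M * 2 ^ n) : ℤ) (M * 2 ^ n) →
    |u ((k + 1) / 2 ^ n) - u (k / 2 ^ n)| ≤ A * θ ^ n

lemma floor_mem_Ico {M n : ℕ} {x : ℝ} (hx : x ∈ Set.Ico (-(M : ℝ)) M) :
    ⌊x * 2 ^ n⌋ ∈ Finset.Ico (-(M * 2 ^ n) : ℤ) (M * 2 ^ n) := by
  have h2 : (0 : ℝ) < 2 ^ n := by positivity
  rw [Finset.mem_Ico, Int.le_floor, Int.floor_lt]
  push_cast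
  constructor
  · nlinarith [hx.1]
  · nlinarith [hx.2]

lemma tendsto_floor_mul_two_pow_div (x : ℝ) (n : ℕ) :
    Tendsto (fun j : ℕ => (⌊x * 2 ^ (n + j)⌋ : ℝ) / 2 ^ (n + j)) atTop (𝓝 x) := by
  have h : Tendsto (fun j : ℕ => x - (1 / 2 : ℝ) ^ (n + j)) atTop (𝓝 x) := by
    have h1 := (tendsto_pow_atTop_nhds_zero_of_lt_one (r := (1 / 2 : ℝ)) (by norm_num)
      (by norm_num)).comp (tendsto_add_atTop_nat n)
    have h2 := h1.const_sub x
    rw [sub_zero] at h2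
    refine h2.congr fun j => ?_
    simp only [Function.comp_apply, add_comm]
  refine tendsto_of_tendsto_of_tendsto_of_le_of_le h tendsto_const_nhds (fun j => ?_) fun j => ?_
  · have h2 : (0 : ℝ) < 2 ^ (n + j) := by positivity
    have := Int.lt_floor_add_one (x * 2 ^ (n + j))
    simp only
    rw [le_div_iff₀ h2, sub_mul, ← mul_pow]
    norm_num
    linarith
  · have h2 : (0 : ℝ) < 2 ^ (n + j) := by positivity
    simp only
    rw [div_le_iff₀ h2]
    exact Int.floor_le _

lemma floor_mul_two (z : ℝ) : ⌊z * 2⌋ = 2 * ⌊z⌋ ∨ ⌊z * 2⌋ = 2 * ⌊z⌋ + 1 := by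
  have h1 := Int.floor_le z
  have h2 := Int.lt_floor_add_one z
  rcases lt_or_ge (z * 2) (2 * ⌊z⌋ + 1) with h | h
  · left; rw [Int.floor_eq_iff]; push_cast; constructor <;> linarith
  · right; rw [Int.floor_eq_iff]; push_cast; constructor <;> linarith

/-- Chaining: successive dyadic floors of `x` coincide or are neighbours on the finer grid, so the
increments along them are dominated by a geometric series. -/
lemma DyadicBound.abs_sub_floor_le {M : ℕ} {A θ : ℝ} {u : C(ℝ, ℝ)} (h : DyadicBound M A θ u)
    (hA : 0 ≤ A) (hθ0 : 0 < θ) (hθ : θ < 1) {x : ℝ} (hx : x ∈ Set.Ico (-(M : ℝ)) M) (n : ℕ) :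
    |u (⌊x * 2 ^ n⌋ / 2 ^ n) - u x| ≤ A * θ ^ n / (1 - θ) := by
  have hlim := (u.continuous.tendsto x).comp (tendsto_floor_mul_two_pow_div x n)
  have := dist_le_of_le_geometric_of_tendsto₀ (f := fun j : ℕ =>
    u (⌊x * 2 ^ (n + j)⌋ / 2 ^ (n + j))) θ (A * θ ^ n) hθ (fun j => ?_) hlim
  · simpa [Real.dist_eq] using this
  · rw [dist_comm, Real.dist_eq]
    have hk := floor_mem_Ico (n := n + j) hx
    have hk' := h (n + (j + 1)) (2 * ⌊x * 2 ^ (n + j)⌋) (by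
      rw [Finset.mem_Ico] at hk ⊢
      rw [← add_assoc, pow_succ]
      constructor <;> linarith)
    have e1 : x * 2 ^ (n + (j + 1)) = x * 2 ^ (n + j) * 2 := by rw [← add_assoc, pow_succ]; ring
    have e2 : (⌊x * 2 ^ (n + j)⌋ : ℝ) / 2 ^ (n + j) =
        ((2 * ⌊x * 2 ^ (n + j)⌋ : ℤ) : ℝ) / 2 ^ (n + (j + 1)) := by
      rw [← add_assoc, pow_succ]; push_cast; field_simp
    have hb : A * θ ^ (n + (j + 1)) ≤ A * θ ^ n * θ ^ j := by
      rw [mul_assoc, ← pow_add]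
      exact mul_le_mul_of_nonneg_left (pow_le_pow_of_le_one hθ0.le hθ.le (by omega)) hA
    rw [e1, e2]
    rcases floor_mul_two (x * 2 ^ (n + j)) with h' | h' <;> rw [h']
    · rw [sub_self, abs_zero]; positivity
    · refine le_trans ?_ hb
      push_cast at hk' ⊢
      exact hk'

/-- Pass through the dyadic floors of level `n`, which are equal or adjacent for points at distance
at most `2⁻ⁿ`. -/
lemma DyadicBound.abs_sub_le {M : ℕ} {A θ : ℝ} {u : C(ℝ, ℝ)} (h : DyadicBound M A θ u)
    (hA : 0 ≤ A) (hθ0 : 0 < θ) (hθ : θ < 1) {x y : ℝ} (hx : x ∈ Set.Ico (-(M : ℝ)) M)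
    (hy : y ∈ Set.Ico (-(M : ℝ)) M) {n : ℕ} (hxy : |x - y| ≤ (1 / 2) ^ n) :
    |u x - u y| ≤ A * (1 + 2 / (1 - θ)) * θ ^ n := by
  wlog hle : x ≤ y generalizing x y
  · rw [abs_sub_comm] at hxy ⊢; exact this hy hx hxy (le_of_not_ge hle)
  have h1 := h.abs_sub_floor_le hA hθ0 hθ hx n
  have h2 := h.abs_sub_floor_le hA hθ0 hθ hy n
  have hp : (0 : ℝ) < 2 ^ n := by positivity
  have h3 : |u (⌊y * 2 ^ n⌋ / 2 ^ n) - u (⌊x * 2 ^ n⌋ / 2 ^ n)| ≤ A * θ ^ n := by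
    have hm : ⌊x * 2 ^ n⌋ ≤ ⌊y * 2 ^ n⌋ := Int.floor_le_floor (by gcongr)
    have hm2 : ⌊y * 2 ^ n⌋ ≤ ⌊x * 2 ^ n⌋ + 1 := by
      rw [← Int.floor_add_one]
      apply Int.floor_le_floor
      rw [abs_sub_comm, abs_of_nonneg (sub_nonneg.2 hle)] at hxy
      have := mul_le_mul_of_nonneg_right hxy hp.le
      rw [← mul_pow] at this
      norm_num at this
      linarith
    rcases hm.eq_or_lt with e | e
    · rw [e, sub_self, abs_zero]; positivity
    · have e' : ⌊y * 2 ^ n⌋ = ⌊x * 2 ^ n⌋ + 1 := by omega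
      rw [e']; push_cast
      exact h n _ (floor_mem_Ico hx)
  have e : u x - u y = -(u (⌊x * 2 ^ n⌋ / 2 ^ n) - u x) + (u (⌊y * 2 ^ n⌋ / 2 ^ n) - u y) -
    (u (⌊y * 2 ^ n⌋ / 2 ^ n) - u (⌊x * 2 ^ n⌋ / 2 ^ n)) := by ring
  rw [e]
  calc _ ≤ A * θ ^ n / (1 - θ) + A * θ ^ n / (1 - θ) + A * θ ^ n := by
        refine (abs_sub _ _).trans (add_le_add ((abs_add_le _ _).trans (add_le_add ?_ h2)) h3)
        rwa [abs_neg]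
    _ = _ := by ring

/-- Arzelà–Ascoli: the dyadic bounds give a common local modulus of continuity, and pointwise
boundedness spreads from `0` to `x` along finitely many steps of length at most `1`. -/
lemma isCompact_closure_setOf_dyadicBound {A : ℕ → ℝ} (hA : ∀ M, 0 ≤ A M) {θ : ℝ} (hθ0 : 0 < θ)
    (hθ : θ < 1) {Q : Set ℝ} (hQ : IsCompact Q) :
    IsCompact (closure {u : C(ℝ, ℝ) | u 0 ∈ Q ∧ ∀ M, DyadicBound M (A M) θ u}) := by
  set s := {u : C(ℝ, ℝ) | u 0 ∈ Q ∧ ∀ M, DyadicBound M (A M) θ u} with hs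
  have : T2Space (UniformOnFun ℝ ℝ {K : Set ℝ | IsCompact K}) :=
    UniformOnFun.t2Space_of_covering (Set.eq_univ_iff_forall.2 fun x =>
      Set.mem_sUnion_of_mem (Set.mem_singleton x) isCompact_singleton)
  have hemb : Topology.IsClosedEmbedding (UniformOnFun.ofFun {K : Set ℝ | IsCompact K} ∘
      ((fun u => u) : C(ℝ, ℝ) → ℝ → ℝ)) :=
    (ContinuousMap.isUniformEmbedding_toUniformOnFunIsCompact (α := ℝ) (β := ℝ)).isClosedEmbedding
  refine ArzelaAscoli.isCompact_closure_of_isClosedEmbedding (fun K hK => hK) hemb ?_ ?_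
  · intro K _
    refine Equicontinuous.equicontinuousOn ?_ K
    intro x
    rw [Metric.equicontinuousAt_iff]
    intro ε hε
    obtain ⟨M, hM⟩ := exists_nat_gt (|x| + 1)
    have hx := abs_lt.1 (show |x| < M by linarith)
    have hlim : Tendsto (fun n : ℕ => A M * (1 + 2 / (1 - θ)) * θ ^ n) atTop (𝓝 0) := by
      simpa using (tendsto_pow_atTop_nhds_zero_of_lt_one hθ0.le hθ).const_mul
        (A M * (1 + 2 / (1 - θ)))
    obtain ⟨n, hn⟩ := (hlim.eventually_lt_const hε).exists
    refine ⟨(1 / 2) ^ n, by positivity, fun y hy u => ?_⟩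
    rw [Real.dist_eq] at hy ⊢
    have hn1 : (1 / 2 : ℝ) ^ n ≤ 1 := pow_le_one₀ (by norm_num) (by norm_num)
    have hy' : |y| < M := by
      have := abs_sub_abs_le_abs_sub y x
      linarith
    have hy'' := abs_lt.1 hy'
    refine lt_of_le_of_lt ?_ hn
    refine (u.2.2 M).abs_sub_le (hA M) hθ0 hθ ⟨hx.1.le, hx.2⟩ ⟨hy''.1.le, hy''.2⟩ ?_
    rw [abs_sub_comm]; exact hy.le
  · intro K _ x _
    obtain ⟨M, hM⟩ := exists_nat_gt |x|
    obtain ⟨R, hR⟩ := hQ.isBounded.subset_closedBall 0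
    set D := A M * (1 + 2 / (1 - θ)) * θ ^ 0
    have hM0 : (0 : ℝ) < M := (abs_nonneg x).trans_lt hM
    refine ⟨Metric.closedBall 0 (R + M * D), isCompact_closedBall _ _, fun u hu => ?_⟩
    have hmem : ∀ j : ℕ, j ≤ M → x * j / M ∈ Set.Ico (-(M : ℝ)) M := by
      intro j hj
      have hj' : (j : ℝ) ≤ M := by exact_mod_cast hj
      have : |x * j / M| < M := by
        rw [abs_div, abs_mul, Nat.abs_cast, Nat.abs_cast, div_lt_iff₀ hM0]
        nlinarith [abs_nonneg x]
      exact ⟨(abs_lt.1 this).1.le, (abs_lt.1 this).2⟩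
    have htel := Finset.sum_range_sub (fun j : ℕ => u (x * j / M)) M
    have h0 := hR hu.1
    rw [mem_closedBall_zero_iff, Real.norm_eq_abs] at h0 ⊢
    simp only [Nat.cast_zero, mul_zero, zero_div] at htel
    rw [mul_div_cancel_right₀ x hM0.ne'] at htel
    have hsum : |u x - u 0| ≤ M * D := by
      rw [← htel]
      refine (Finset.abs_sum_le_sum_abs _ _).trans ?_
      refine (Finset.sum_le_card_nsmul _ _ D fun j hj => ?_).trans (by simp)
      have hj := Finset.mem_range.1 hj
      refine (hu.2 M).abs_sub_le (hA M) hθ0 hθ (hmem _ hj) (hmem _ hj.le) ?_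
      rw [← sub_div, ← mul_sub, pow_zero]
      push_cast
      rw [add_sub_cancel_left, mul_one, abs_div, Nat.abs_cast, div_le_one hM0]
      exact hM.le
    have := abs_sub_abs_le_abs_sub (u x) (u 0)
    linarith

/-- Markov's inequality and a union bound over the `2M * 2ⁿ` intervals of level `n`. The resulting
ratio is `(1/2) / (9/10)⁴ = 5000/6561`; any rate `θ < 1` with `θ⁴ > 1/2` would serve. -/
lemma measure_not_dyadicBound_le {C : ℝ} (hC : 0 ≤ C) (μ : Measure C(ℝ, ℝ))
    (h : ∀ x y : ℝ, ∫⁻ u, ENNReal.ofReal ((u x - u y) ^ 4) ∂μ ≤ ENNReal.ofReal (C * (x - y) ^ 2))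
    (M : ℕ) {A : ℝ} (hA : 0 < A) :
    μ {u | ¬ DyadicBound M A (9 / 10) u} ≤
      ENNReal.ofReal (2 * M * C / A ^ 4 * (1 - 5000 / 6561)⁻¹) := by
  have hsub : {u : C(ℝ, ℝ) | ¬ DyadicBound M A (9 / 10) u} ⊆
      ⋃ n : ℕ, ⋃ k ∈ Finset.Ico (-(M * 2 ^ n) : ℤ) (M * 2 ^ n),
        {u : C(ℝ, ℝ) | ENNReal.ofReal ((A * (9 / 10) ^ n) ^ 4) ≤
          ENNReal.ofReal ((u ((k + 1) / 2 ^ n) - u (k / 2 ^ n)) ^ 4)} := by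
    intro u hu
    simp only [DyadicBound, Set.mem_ofPred_eq, not_forall, not_le] at hu
    obtain ⟨n, k, hk, hlt⟩ := hu
    simp only [Set.mem_iUnion, Set.mem_ofPred_eq]
    refine ⟨n, k, hk, ENNReal.ofReal_le_ofReal ?_⟩
    have : (u ((k + 1) / 2 ^ n) - u (k / 2 ^ n)) ^ 4 =
        |u ((k + 1) / 2 ^ n) - u (k / 2 ^ n)| ^ 4 := by
      rw [pow_abs, abs_of_nonneg (by positivity)]
    rw [this]
    exact pow_le_pow_left₀ (by positivity) hlt.le 4
  refine (measure_mono hsub).trans ((measure_iUnion_le _).trans ?_)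
  have hn : ∀ n : ℕ, μ (⋃ k ∈ Finset.Ico (-(M * 2 ^ n) : ℤ) (M * 2 ^ n),
        {u : C(ℝ, ℝ) | ENNReal.ofReal ((A * (9 / 10) ^ n) ^ 4) ≤
          ENNReal.ofReal ((u ((k + 1) / 2 ^ n) - u (k / 2 ^ n)) ^ 4)}) ≤
      ENNReal.ofReal (2 * M * C / A ^ 4 * (5000 / 6561) ^ n) := by
    intro n
    refine (measure_biUnion_finset_le _ _).trans ?_
    have hk : ∀ k ∈ Finset.Ico (-(M * 2 ^ n) : ℤ) (M * 2 ^ n),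
        μ {u : C(ℝ, ℝ) | ENNReal.ofReal ((A * (9 / 10) ^ n) ^ 4) ≤
          ENNReal.ofReal ((u ((k + 1) / 2 ^ n) - u (k / 2 ^ n)) ^ 4)} ≤
        ENNReal.ofReal (C * (1 / 2 ^ n) ^ 2 / (A * (9 / 10) ^ n) ^ 4) := by
      intro k _
      have hpos : 0 < (A * (9 / 10) ^ n) ^ 4 := by positivity
      have hmeas : Measurable fun u : C(ℝ, ℝ) =>
          ENNReal.ofReal ((u ((k + 1) / 2 ^ n) - u (k / 2 ^ n)) ^ 4) := by
        refine ENNReal.measurable_ofReal.comp (Continuous.measurable ?_)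
        have h1 := continuous_eval_const (F := C(ℝ, ℝ)) (((k : ℝ) + 1) / 2 ^ n)
        have h2 := continuous_eval_const (F := C(ℝ, ℝ)) ((k : ℝ) / 2 ^ n)
        exact (h1.sub h2).pow 4
      refine (meas_ge_le_lintegral_div hmeas.aemeasurable
        (by simpa using hpos) ENNReal.ofReal_ne_top).trans ?_
      rw [ENNReal.ofReal_div_of_pos hpos]
      refine ENNReal.div_le_div_right ((h _ _).trans (le_of_eq ?_)) _
      congr 2
      ring
    refine (Finset.sum_le_card_nsmul _ _ _ hk).trans (le_of_eq ?_)
    rw [Int.card_Ico, nsmul_eq_mul, ← ENNReal.ofReal_natCast, ← ENNReal.ofReal_mul (by positivity)]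
    congr 1
    have : ((((M : ℤ) * 2 ^ n - -(M * 2 ^ n)).toNat : ℕ) : ℝ) = 2 * M * 2 ^ n := by
      rw [show ((M : ℤ) * 2 ^ n - -(M * 2 ^ n)) = ((2 * M * 2 ^ n : ℕ) : ℤ) by push_cast; ring,
        Int.toNat_natCast]
      push_cast; ring
    rw [this, mul_pow A, ← pow_mul (9 / 10 : ℝ), mul_comm n 4, pow_mul (9 / 10 : ℝ),
      show (5000 / 6561 : ℝ) = 1 / 2 / ((9 / 10) ^ 4) by norm_num,
      div_pow (1 / 2 : ℝ), one_div_pow (2 : ℝ)]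
    field_simp
  refine (ENNReal.tsum_le_tsum hn).trans (le_of_eq ?_)
  have hg := hasSum_geometric_of_lt_one (r := (5000 / 6561 : ℝ)) (by norm_num) (by norm_num)
  have hg' := hg.mul_left (2 * M * C / A ^ 4)
  rw [← ENNReal.ofReal_tsum_of_nonneg (fun n => by positivity) hg'.summable, hg'.tsum_eq]

/-- Kolmogorov's tightness criterion on the line. -/
theorem isTightMeasureSet_of_moment_bound {ι : Type*} {C : ℝ} (hC : 0 ≤ C)
    (μ : ι → Measure C(ℝ, ℝ))
    (h : ∀ i (x y : ℝ), ∫⁻ u, ENNReal.ofReal ((u x - u y) ^ 4) ∂(μ i) ≤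
      ENNReal.ofReal (C * (x - y) ^ 2))
    (h0 : IsTightMeasureSet (Set.range fun i => (μ i).map (fun u => u 0))) :
    IsTightMeasureSet (Set.range μ) := by
  rw [isTightMeasureSet_iff_exists_isCompact_measure_compl_le] at h0 ⊢
  intro ε hε
  have hε2 : 0 < ε / 2 := ENNReal.half_pos hε.ne'
  obtain ⟨Q, hQ, hQm⟩ := h0 (ε / 2) hε2
  -- Half of `ε` is spent on the value at `0`. The other half is shared among the windows `[-M, M]`,
  -- each with its own constant `A M`.
  obtain ⟨δ, hδ0, hδ⟩ := ENNReal.exists_pos_sum_of_countable' hε2.ne' ℕ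
  have hex : ∀ M : ℕ, ∃ A : ℝ, 0 < A ∧
      ENNReal.ofReal (2 * M * C / A ^ 4 * (1 - 5000 / 6561)⁻¹) ≤ δ M := by
    intro M
    have hl : Tendsto (fun A : ℝ => ENNReal.ofReal (2 * M * C / A ^ 4 * (1 - 5000 / 6561)⁻¹))
        atTop (𝓝 0) := by
      have h1 : Tendsto (fun A : ℝ => 2 * M * C / A ^ 4 * (1 - 5000 / 6561 : ℝ)⁻¹) atTop (𝓝 0) := by
        have := ((tendsto_pow_atTop (α := ℝ) (n := 4) (by norm_num)).const_div_atTop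
          (2 * M * C)).mul_const ((1 - 5000 / 6561 : ℝ)⁻¹)
        simpa using this
      simpa using ENNReal.tendsto_ofReal h1
    obtain ⟨A, hA, hA'⟩ := ((hl.eventually_le_const (hδ0 M)).and (eventually_gt_atTop 0)).exists
    exact ⟨A, hA', hA⟩
  choose A hA hAδ using hex
  refine ⟨_, isCompact_closure_setOf_dyadicBound (fun M => (hA M).le)
    (by norm_num : (0 : ℝ) < 9 / 10) (by norm_num) hQ, ?_⟩
  rintro _ ⟨i, rfl⟩
  have hsub : (closure {u : C(ℝ, ℝ) | u 0 ∈ Q ∧ ∀ M, DyadicBound M (A M) (9 / 10) u})ᶜ ⊆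
      (fun u : C(ℝ, ℝ) => u 0) ⁻¹' Qᶜ ∪ ⋃ M, {u | ¬ DyadicBound M (A M) (9 / 10) u} := by
    refine (Set.compl_subset_compl.2 subset_closure).trans fun u hu => ?_
    simp only [Set.mem_compl_iff, Set.mem_ofPred_eq, not_and_or, not_forall] at hu
    simpa using hu
  refine (measure_mono hsub).trans ((measure_union_le _ _).trans ?_)
  rw [← ENNReal.add_halves ε]
  refine add_le_add ?_ ?_
  · have h1 := hQm _ ⟨i, rfl⟩
    rwa [Measure.map_apply (continuous_eval_const (F := C(ℝ, ℝ)) 0).measurable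
      hQ.measurableSet.compl] at h1
  · exact (measure_iUnion_le _).trans ((ENNReal.tsum_le_tsum fun M =>
      (measure_not_dyadicBound_le hC (μ i) (h i) M (hA M)).trans (hAδ M)).trans hδ.le)

end WeaklyAsymmetricBridge

namespace WeaklyAsymmetricBridge
open scoped Topology ENNReal

/-! ### Weak convergence in the space of continuous functions on the line -/

/-- The linear functional `u ↦ ∑ₓ θ(x) u(x)`, as a bilinear map. -/
noncomputable def evalPairing : C(ℝ, ℝ) →ₗ[ℝ] (ℝ →₀ ℝ) →ₗ[ℝ] ℝ :=
  LinearMap.mk₂ ℝ (fun u θ => θ.sum fun x c => c * u x)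
    (fun u v θ => by simp [Finsupp.sum, mul_add, Finset.sum_add_distrib])
    (fun r u θ => by
      simp only [Finsupp.sum, ContinuousMap.coe_smul, Pi.smul_apply, smul_eq_mul, Finset.mul_sum]
      exact Finset.sum_congr rfl fun x _ => by ring)
    (fun u θ η => Finsupp.sum_add_index' (by simp) (by intros; ring))
    (fun r u θ => by
      rw [Finsupp.sum_smul_index' (by simp), Finsupp.smul_sum]
      simp [mul_assoc])

lemma evalPairing_apply (u : C(ℝ, ℝ)) (θ : ℝ →₀ ℝ) :
    evalPairing u θ = ∑ x ∈ θ.support, θ x * u x := rfl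

lemma evalPairing_single (u : C(ℝ, ℝ)) (x c : ℝ) :
    evalPairing u (Finsupp.single x c) = c * u x :=
  Finsupp.sum_single_index (h := fun x c => c * u x) (zero_mul _)

lemma continuous_evalPairing (θ : ℝ →₀ ℝ) : Continuous fun u => evalPairing u θ := by
  simp_rw [evalPairing_apply]
  exact continuous_finsetSum _ fun x _ => (continuous_eval_const x).const_mul _

/-- The characteristic functional of a law on the space of continuous functions. -/
noncomputable def charFunctional (μ : Measure C(ℝ, ℝ)) (θ : ℝ →₀ ℝ) : ℂ :=
  ∫ u, Complex.exp ((evalPairing u θ : ℝ) * Complex.I) ∂μ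

lemma charFun_map_evalPairing (μ : Measure C(ℝ, ℝ)) (θ : ℝ →₀ ℝ) (t : ℝ) :
    charFun (μ.map fun u => evalPairing u θ) t = charFunctional μ (t • θ) := by
  rw [charFun_apply_real, integral_map (continuous_evalPairing θ).aemeasurable
    (Continuous.aestronglyMeasurable (by fun_prop)), charFunctional]
  simp

/-- Trigonometric polynomials in finitely many evaluations form an algebra separating the points of
`C(ℝ, ℝ)`; for tight sequences, convergence of their integrals suffices. -/
theorem tendsto_of_tendsto_charFunctional {μ : ℕ → ProbabilityMeasure C(ℝ, ℝ)}
    {μ₀ : ProbabilityMeasure C(ℝ, ℝ)}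
    (ht : IsTightMeasureSet (Set.range fun n => (μ n : Measure C(ℝ, ℝ))))
    (h : ∀ θ, Tendsto (fun n => charFunctional (μ n) θ) atTop (𝓝 (charFunctional μ₀ θ))) :
    Tendsto μ atTop (𝓝 μ₀) := by
  -- With the discrete topology on the test vectors, joint continuity of the pairing reduces to
  -- continuity in `u`.
  let : TopologicalSpace (ℝ →₀ ℝ) := ⊥
  have : DiscreteTopology (ℝ →₀ ℝ) := ⟨rfl⟩
  have hL : Continuous fun p : C(ℝ, ℝ) × (ℝ →₀ ℝ) => evalPairing p.1 p.2 :=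
    continuous_prod_of_discrete_right.2 fun θ => continuous_evalPairing θ
  refine ProbabilityMeasure.tendsto_of_tight_of_separatesPoints (𝕜 := ℂ) ht
    (A := BoundedContinuousFunction.charPoly Real.continuous_probChar hL) ?_ ?_
  · refine BoundedContinuousFunction.separatesPoints_charPoly
      Real.continuous_probChar Real.probChar_ne_one hL ?_
    intro v hv
    obtain ⟨x, hx⟩ := DFunLike.ne_iff.1 hv
    exact DFunLike.ne_iff.2 ⟨Finsupp.single x 1, by simpa [evalPairing_single] using hx⟩
  · intro g hg
    rw [BoundedContinuousFunction.mem_charPoly] at hg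
    obtain ⟨w, hw⟩ := hg
    have heq (ν : Measure C(ℝ, ℝ)) (hν : IsProbabilityMeasure ν) :
        ∫ x, g x ∂ν = w.coeff.sum (fun θ z => z * charFunctional ν θ) := by
      simp_rw [hw, Finsupp.sum]
      rw [integral_finsetSum]
      · congr with y
        rw [integral_const_mul]
        rfl
      · refine fun i hi => Integrable.const_mul ?_ _
        exact BoundedContinuousFunction.integrable ν
          (BoundedContinuousFunction.char Real.continuous_probChar hL i)
    simp_rw [heq (μ _) inferInstance, heq μ₀ inferInstance]
    exact tendsto_finsetSum _ fun θ _ => (h θ).const_mul _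

/-- A tight sequence of laws whose characteristic functionals converge has a limit point with the
limiting characteristic functional. -/
theorem exists_charFunctional_eq {μ : ℕ → ProbabilityMeasure C(ℝ, ℝ)}
    (ht : IsTightMeasureSet (Set.range fun n => (μ n : Measure C(ℝ, ℝ)))) {Φ : (ℝ →₀ ℝ) → ℂ}
    (h : ∀ θ, Tendsto (fun n => charFunctional (μ n) θ) atTop (𝓝 (Φ θ))) :
    ∃ ν : ProbabilityMeasure C(ℝ, ℝ), ∀ θ, charFunctional ν θ = Φ θ := by
  have hc : IsCompact (closure (Set.range μ)) := isCompact_closure_of_isTightMeasureSet (by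
    convert ht using 1
    ext; simp)
  -- A limit along a nonprincipal ultrafilter is enough, so no convergent subsequence has to be
  -- extracted.
  obtain ⟨ν, -, hν⟩ := hc.ultrafilter_le_nhds ((hyperfilter ℕ).map μ)
    (.trans (by simp) (monotone_principal subset_closure))
  have hν' : Tendsto μ (hyperfilter ℕ : Filter ℕ) (𝓝 ν) := hν
  refine ⟨ν, fun θ => tendsto_nhds_unique ?_ ((h θ).mono_left Nat.hyperfilter_le_atTop)⟩
  rw [ProbabilityMeasure.tendsto_iff_forall_integral_rclike_tendsto ℂ] at hν'
  let g : BoundedContinuousFunction C(ℝ, ℝ) ℂ := BoundedContinuousFunction.ofNormedAddCommGroup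
    (fun u => Complex.exp ((evalPairing u θ : ℝ) * Complex.I))
    (by have := continuous_evalPairing θ; fun_prop) 1
    (fun u => by rw [Complex.norm_exp_ofReal_mul_I])
  exact hν' g

/-! ### Gaussian laws -/

/-- The quadratic form with kernel `R`. -/
noncomputable def quadForm (R : ℝ → ℝ → ℝ) (θ : ℝ →₀ ℝ) : ℝ :=
  θ.sum fun x c => θ.sum fun y d => c * d * R x y

lemma quadForm_smul (R : ℝ → ℝ → ℝ) (t : ℝ) (θ : ℝ →₀ ℝ) :
    quadForm R (t • θ) = t ^ 2 * quadForm R θ := by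
  unfold quadForm
  rw [Finsupp.sum_smul_index' (by simp), Finsupp.mul_sum]
  refine Finsupp.sum_congr fun x _ => ?_
  rw [Finsupp.sum_smul_index' (by simp), Finsupp.mul_sum]
  refine Finsupp.sum_congr fun y _ => ?_
  simp only [smul_eq_mul]; ring

lemma quadForm_single (R : ℝ → ℝ → ℝ) (x : ℝ) : quadForm R (Finsupp.single x 1) = R x x := by
  simp [quadForm]

lemma quadForm_single_add (R : ℝ → ℝ → ℝ) (x y : ℝ) :
    quadForm R (Finsupp.single x 1 + Finsupp.single y 1) = R x x + R x y + (R y x + R y y) := by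
  have h (z c : ℝ) : ((Finsupp.single x (1 : ℝ) + Finsupp.single y 1).sum
      fun w d => c * d * R z w) = c * R z x + c * R z y := by
    rw [Finsupp.sum_add_index' (by simp) (by intros; ring)]; simp
  unfold quadForm
  simp_rw [h]
  rw [Finsupp.sum_add_index' (by simp) (by intros; ring)]
  simp

section Gaussian

variable {R : ℝ → ℝ → ℝ} {ν : Measure C(ℝ, ℝ)} [IsProbabilityMeasure ν]

lemma quadForm_nonneg (h : ∀ θ, charFunctional ν θ = (Real.exp (-quadForm R θ / 2) : ℝ))
    (θ : ℝ →₀ ℝ) : 0 ≤ quadForm R θ := by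
  have h1 : ‖charFunctional ν θ‖ ≤ 1 := by
    refine (norm_integral_le_integral_norm _).trans ?_
    simp [Complex.norm_exp_ofReal_mul_I]
  rw [h, Complex.norm_real, Real.norm_eq_abs, abs_of_pos (Real.exp_pos _),
    Real.exp_le_one_iff] at h1
  linarith

/-- Along the ray `t • θ` the characteristic functional is the characteristic function of a single
linear statistic. -/
lemma map_evalPairing_eq (h : ∀ θ, charFunctional ν θ = (Real.exp (-quadForm R θ / 2) : ℝ))
    (θ : ℝ →₀ ℝ) :
    ν.map (fun u => evalPairing u θ) = gaussianReal 0 (quadForm R θ).toNNReal := by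
  have : IsProbabilityMeasure (ν.map fun u => evalPairing u θ) :=
    Measure.isProbabilityMeasure_map (continuous_evalPairing θ).aemeasurable
  refine Measure.ext_of_charFun (funext fun t => ?_)
  rw [charFun_map_evalPairing, h, quadForm_smul, charFun_gaussianReal, Complex.ofReal_exp]
  congr 1
  push_cast [Real.coe_toNNReal _ (quadForm_nonneg h θ)]
  ring

lemma hasLaw_evalPairing (h : ∀ θ, charFunctional ν θ = (Real.exp (-quadForm R θ / 2) : ℝ))
    (θ : ℝ →₀ ℝ) :
    HasLaw (fun u => evalPairing u θ) (gaussianReal 0 (quadForm R θ).toNNReal) ν :=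
  ⟨(continuous_evalPairing θ).aemeasurable, map_evalPairing_eq h θ⟩

lemma variance_evalPairing (h : ∀ θ, charFunctional ν θ = (Real.exp (-quadForm R θ / 2) : ℝ))
    (θ : ℝ →₀ ℝ) : Var[fun u => evalPairing u θ; ν] = quadForm R θ := by
  rw [(hasLaw_evalPairing h θ).variance_eq, variance_id_gaussianReal,
    Real.coe_toNNReal _ (quadForm_nonneg h θ)]

/-- Polarisation of the variances of `u x`, `u y` and `u x + u y`. -/
lemma covariance_eval_eq (h : ∀ θ, charFunctional ν θ = (Real.exp (-quadForm R θ / 2) : ℝ))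
    (hR : ∀ x y, R x y = R y x) (x y : ℝ) :
    cov[fun u : C(ℝ, ℝ) => u x, fun u => u y; ν] = R x y := by
  have hx (x : ℝ) : (fun u => evalPairing u (Finsupp.single x 1)) = fun u : C(ℝ, ℝ) => u x := by
    funext u; rw [evalPairing_single, one_mul]
  have hL (x : ℝ) : MemLp (fun u : C(ℝ, ℝ) => u x) 2 ν := by
    have := (hasLaw_evalPairing h (Finsupp.single x 1))
    rw [hx] at this
    have hg : HasGaussianLaw (fun u : C(ℝ, ℝ) => u x) ν := ⟨by rw [this.map_eq]; infer_instance⟩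
    exact hg.memLp_two
  have h1 := variance_evalPairing h (Finsupp.single x 1 + Finsupp.single y 1)
  have h2 := variance_evalPairing h (Finsupp.single x 1)
  have h3 := variance_evalPairing h (Finsupp.single y 1)
  simp only [map_add, evalPairing_single, one_mul] at h1 h2 h3
  rw [variance_fun_add (hL x) (hL y), h2, h3, quadForm_single_add, quadForm_single,
    quadForm_single, hR y x] at h1
  linarith

end Gaussian

/-- The restriction of a function on the line to `[0,1]`. -/
noncomputable def restrictUnit : C(C(ℝ, ℝ), C(unitInterval, ℝ)) :=
  ⟨fun u => u.comp ⟨Subtype.val, continuous_subtype_val⟩, ContinuousMap.continuous_precomp _⟩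

lemma restrictUnit_apply (u : C(ℝ, ℝ)) (x : unitInterval) : restrictUnit u x = u x := rfl

/-- A law on functions of the line with the characteristic functional of a Brownian bridge
restricts to a Brownian bridge. -/
theorem isBrownianBridge_of_charFunctional {R : ℝ → ℝ → ℝ} {ν : Measure C(ℝ, ℝ)}
    [IsProbabilityMeasure ν]
    (h : ∀ θ, charFunctional ν θ = (Real.exp (-quadForm R θ / 2) : ℝ))
    (hR : ∀ x y, R x y = R y x)
    (hR' : ∀ s t : unitInterval, s ≤ t → R s t = (s : ℝ) * (1 - t)) :
    IsBrownianBridge (fun w => w) (ν.map restrictUnit) where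
  measurable := measurable_id
  isGaussianProcess := by
    refine ⟨fun I => ⟨?_⟩⟩
    have hm : Measurable fun (w : C(unitInterval, ℝ)) => I.restrict fun t => w t :=
      measurable_pi_lambda _ fun i => (continuous_eval_const (i : unitInterval)).measurable
    refine isGaussian_of_map_eq_gaussianReal fun L => ?_
    classical
    -- A linear form on finitely many coordinates is the pairing with this vector, so its law is
    -- already known to be Gaussian.
    let θ : ℝ →₀ ℝ := ∑ i : I, Finsupp.single ((i : unitInterval) : ℝ) (L (Pi.single i 1))
    refine ⟨0, (quadForm R θ).toNNReal, ?_⟩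
    rw [← map_evalPairing_eq h θ, Measure.map_map L.continuous.measurable hm,
      Measure.map_map (L.continuous.measurable.comp hm) restrictUnit.continuous.measurable]
    congr 1
    funext u
    have hL (x : I → ℝ) : L x = ∑ i, x i * L (Pi.single i 1) := by
      conv_lhs => rw [← Finset.univ_sum_single x]
      rw [map_sum]
      refine Finset.sum_congr rfl fun i _ => ?_
      rw [show (Pi.single i (x i) : I → ℝ) = x i • Pi.single i (1 : ℝ) by
        rw [← Pi.single_smul]; simp, map_smul, smul_eq_mul]
    simp only [Function.comp_apply]
    rw [hL, map_sum]
    refine Finset.sum_congr rfl fun i _ => ?_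
    rw [evalPairing_single, mul_comm]
    rfl
  mean t := by
    rw [integral_map restrictUnit.continuous.aemeasurable
      (continuous_eval_const t).aestronglyMeasurable]
    have := (hasLaw_evalPairing h (Finsupp.single (t : ℝ) 1)).integral_eq
    rw [integral_id_gaussianReal] at this
    simpa [evalPairing_single, restrictUnit_apply] using this
  covariance s t hst := by
    rw [covariance_map (continuous_eval_const s).aestronglyMeasurable
      (continuous_eval_const t).aestronglyMeasurable restrictUnit.continuous.aemeasurable,
      ← hR' s t hst]
    exact covariance_eval_eq h hR s t

/-! ### Covariances and time changes of a Brownian bridge -/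

section Bridge

variable {Ω : Type*} [MeasurableSpace Ω] {P : Measure Ω}
  {b : Ω → C(unitInterval, ℝ)}

lemma IsBrownianBridge.memLp (hb : IsBrownianBridge b P) (s : unitInterval) :
    MemLp (fun ω => b ω s) 2 P := (hb.isGaussianProcess.hasGaussianLaw_eval s).memLp_two

lemma IsBrownianBridge.covariance_eq (hb : IsBrownianBridge b P) (s t : unitInterval) :
    cov[fun ω => b ω s, fun ω => b ω t; P] = min (s : ℝ) t - s * t := by
  rcases le_total s t with h | h
  · rw [hb.covariance s t h, min_eq_left (by exact_mod_cast h)]; ring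
  · rw [covariance_comm, hb.covariance t s h, min_eq_right (by exact_mod_cast h)]; ring

lemma IsBrownianBridge.integral_mul [IsProbabilityMeasure P] (hb : IsBrownianBridge b P)
    (s t : unitInterval) :
    ∫ ω, b ω s * b ω t ∂P = min (s : ℝ) t - s * t := by
  have := covariance_eq_sub (hb.memLp s) (hb.memLp t)
  rw [hb.covariance_eq, hb.mean, hb.mean] at this
  simpa using this.symm

/-- The characteristic functional of a multiple of a time-changed Brownian bridge. -/
theorem IsBrownianBridge.charFunctional_eq [IsProbabilityMeasure P] (hb : IsBrownianBridge b P)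
    (τ : ℝ → unitInterval) (c : ℝ) {B : Ω → C(ℝ, ℝ)} (hB : Measurable B) (hBτ : ∀ ω x, B ω x = c * b ω (τ x))
    (θ : ℝ →₀ ℝ) :
    charFunctional (P.map B) θ =
      (Real.exp (-quadForm (fun x y => c ^ 2 * (min (τ x : ℝ) (τ y) - τ x * τ y)) θ / 2) : ℝ) := by
  have hmeas := (continuous_evalPairing θ).measurable
  have hfun : (fun ω => evalPairing (B ω) θ) =
      fun ω => ∑ x ∈ θ.support, (θ x * c) • b ω (τ x) := by
    funext ω
    rw [evalPairing_apply]
    exact Finset.sum_congr rfl fun x _ => by rw [hBτ, smul_eq_mul]; ring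
  have hG : HasGaussianLaw (fun ω => evalPairing (B ω) θ) P := by
    rw [hfun]
    exact ((hb.isGaussianProcess.comp_right τ).smul fun x => θ x * c).hasGaussianLaw_fun_sum
  have hi (x : ℝ) : Integrable (fun ω => (θ x * c) • b ω (τ x)) P :=
    ((hb.memLp (τ x)).integrable (by norm_num)).smul (θ x * c)
  have hmean : ∫ ω, evalPairing (B ω) θ ∂P = 0 := by
    rw [hfun, integral_finsetSum _ fun x _ => hi x]
    refine Finset.sum_eq_zero fun x _ => ?_
    rw [integral_smul, hb.mean, smul_zero]
  have hvar : Var[fun ω => evalPairing (B ω) θ; P] =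
      quadForm (fun x y => c ^ 2 * (min (τ x : ℝ) (τ y) - τ x * τ y)) θ := by
    have hL (x : ℝ) : MemLp (fun ω => (θ x * c) • b ω (τ x)) 2 P :=
      (hb.memLp (τ x)).const_smul (θ x * c)
    rw [hfun, variance_fun_sum' fun x _ => hL x]
    refine Finset.sum_congr rfl fun x _ => Finset.sum_congr rfl fun y _ => ?_
    simp only [smul_eq_mul]
    rw [covariance_const_mul_left, covariance_const_mul_right, hb.covariance_eq]
    ring
  have hchar := hG.charFun_map_eq 1
  simp only [RCLike.inner_apply, conj_trivial, mul_one] at hchar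
  rw [hmean, hvar, charFun_apply_real,
    integral_map (φ := fun ω => evalPairing (B ω) θ) (hmeas.comp hB).aemeasurable
    (Continuous.aestronglyMeasurable (by fun_prop))] at hchar
  rw [charFunctional, integral_map hB.aemeasurable (Continuous.aestronglyMeasurable (by
    have := continuous_evalPairing θ; fun_prop)), Complex.ofReal_exp]
  simp only [Complex.ofReal_one, one_mul, Complex.ofReal_zero, zero_mul, zero_sub] at hchar
  rw [hchar]
  congr 1
  push_cast; ring

end Bridge

end WeaklyAsymmetricBridge

namespace WeaklyAsymmetricBridge
open scoped Topology ENNReal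

/-! ### The invariance principle for the rescaled fluctuations -/

/-- The centred height around the position `c`, rescaled diffusively with space scale `a`. -/
noncomputable def scaledFluct (σ α c a : ℝ) {N : ℕ} (S : Bridge N) : C(ℝ, ℝ) where
  toFun x := centredHeight σ α S (c + x * a) / √a
  continuous_toFun := ((continuous_centredHeight σ α S).comp (by fun_prop)).div_const _

lemma measurable_bridge {N : ℕ} {E : Type*} [MeasurableSpace E] (f : Bridge N → E) :
    Measurable f := fun _ _ => trivial

lemma clip_mul_one_sub_le (i : ℕ) (t : ℝ) :
    clip i t * (1 - clip i t) ≤ clip i t - clip (i + 1) t := by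
  rcases le_or_gt t i with h | h
  · rw [clip_of_ge h, clip_of_ge (by push_cast; linarith)]; simp
  · rcases le_or_gt ((i : ℝ) + 1) t with h' | h'
    · rw [clip_of_le h']; simpa using clip_le_one (i + 1) t
    · rw [clip_of_ge (i := i + 1) (by push_cast; linarith)]
      nlinarith [clip_nonneg i t]

/-- At most one weight, that of the step under way at `t`, is neither `0` nor `1`; the bound is
obtained by telescoping. -/
lemma sum_clip_mul_one_sub_le (n : ℕ) (t : ℝ) :
    ∑ i : Fin n, clip i t * (1 - clip i t) ≤ 1 := by
  rw [← Finset.sum_range (fun i => clip i t * (1 - clip i t))]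
  refine (Finset.sum_le_sum fun i _ => clip_mul_one_sub_le i t).trans ?_
  rw [Finset.sum_range_sub' (fun i => clip i t)]
  linarith [clip_le_one 0 t, clip_nonneg n t]

/-- The weights are almost indicators, so for `s ≤ t` their product is almost the weight at `s`. The
error is bounded, hence negligible after division by the scale. -/
lemma abs_sum_sechSq_clip_mul_sub_le (σ α : ℝ) (N : ℕ) {s t : ℝ} (hst : s ≤ t) :
    |∑ i, sechSq (stepTilt σ α N i) * (clip i s * clip i t) -
      ∑ i, sechSq (stepTilt σ α N i) * clip i s| ≤ 1 := by
  rw [← Finset.sum_sub_distrib]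
  refine (Finset.abs_sum_le_sum_abs _ _).trans
    ((Finset.sum_le_sum fun i _ => ?_).trans (sum_clip_mul_one_sub_le (2 * N) s))
  have h0 := clip_nonneg i s
  have h1 := clip_le_one i t
  have h2 := clip_mono i hst
  have h3 := sechSq_pos (stepTilt σ α N i)
  have h4 := sechSq_le_one (stepTilt σ α N i)
  rw [← mul_sub, abs_mul, abs_of_pos h3, abs_sub_comm, ← mul_one_sub,
    abs_of_nonneg (mul_nonneg h0 (by linarith))]
  calc _ ≤ 1 * (clip i s * (1 - clip i t)) := by
        gcongr
    _ ≤ _ := by rw [one_mul]; gcongr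

/-- The limiting covariance, in terms of the limiting variance profile `F` with total mass `Q`. -/
noncomputable def bridgeCov (F : ℝ → ℝ) (Q x y : ℝ) : ℝ := F (min x y) - F x * F y / Q

lemma bridgeCov_comm (F : ℝ → ℝ) (Q x y : ℝ) : bridgeCov F Q x y = bridgeCov F Q y x := by
  unfold bridgeCov; rw [min_comm, mul_comm (F x)]

/-- The assumption that the variance of the tilted steps up to `c + x a`, divided by `a`, converges
to `F x`, with total variance converging to `Q`. -/
structure VarianceProfile (σ α : ℝ) (c a : ℕ → ℝ) (F : ℝ → ℝ) (Q : ℝ) : Prop where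
  tendsto_scale : Tendsto a atTop atTop
  pos : 0 < Q
  tendsto_total : Tendsto (fun N => totalVariance σ α N / a N) atTop (𝓝 Q)
  tendsto_profile : ∀ x, Tendsto (fun N =>
    (∑ i, sechSq (stepTilt σ α N i) * clip i (c N + x * a N)) / a N) atTop (𝓝 (F x))

section Invariance

variable {σ α : ℝ} {c a : ℕ → ℝ} {F : ℝ → ℝ} {Q : ℝ}

lemma VarianceProfile.tendsto_mul (h : VarianceProfile σ α c a F Q) (x y : ℝ) :
    Tendsto (fun N => (∑ i, sechSq (stepTilt σ α N i) *
      (clip i (c N + x * a N) * clip i (c N + y * a N))) / a N) atTop (𝓝 (F (min x y))) := by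
  wlog hxy : x ≤ y generalizing x y
  · have := this y x (le_of_not_ge hxy)
    simpa only [mul_comm (clip _ (c _ + x * a _)), min_comm x y] using this
  rw [min_eq_left hxy]
  refine tendsto_of_tendsto_of_dist (h.tendsto_profile x) ?_
  have h0 : Tendsto (fun N => 1 / a N) atTop (𝓝 0) := h.tendsto_scale.const_div_atTop 1
  refine squeeze_zero' (Eventually.of_forall fun N => dist_nonneg) ?_ h0
  filter_upwards [h.tendsto_scale.eventually_gt_atTop 0] with N hN
  rw [dist_comm, Real.dist_eq, ← sub_div, abs_div, abs_of_pos hN]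
  gcongr
  exact abs_sum_sechSq_clip_mul_sub_le σ α N (by gcongr)

lemma evalPairing_scaledFluct (σ α c a : ℝ) {N : ℕ} (S : Bridge N) (θ : ℝ →₀ ℝ) :
    evalPairing (scaledFluct σ α c a S) θ =
      ∑ i : Fin (2 * N), (∑ x ∈ θ.support, θ x * clip i (c + x * a)) / √a *
        (step S i - Real.tanh (stepTilt σ α N i)) := by
  rw [evalPairing_apply]
  have : ∀ x, scaledFluct σ α c a S x = ∑ i : Fin (2 * N), clip i (c + x * a) *
      (step S i - Real.tanh (stepTilt σ α N i)) / √a := by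
    intro x
    rw [← Finset.sum_div, ← centredHeight_eq]; rfl
  simp_rw [this, Finset.mul_sum]
  rw [Finset.sum_comm]
  refine Finset.sum_congr rfl fun i _ => ?_
  rw [Finset.sum_div, Finset.sum_mul]
  exact Finset.sum_congr rfl fun x _ => by ring

lemma charFunctional_scaledFluct (σ α c a : ℝ) (N : ℕ) (θ : ℝ →₀ ℝ) :
    charFunctional ((invMeasure σ α N).map (scaledFluct σ α c a)) θ =
      ∫ S : Bridge N, Complex.exp ((evalPairing (scaledFluct σ α c a S) θ : ℝ) * Complex.I)
        ∂(invMeasure σ α N) :=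
  integral_map (measurable_bridge _).aemeasurable (Continuous.aestronglyMeasurable (by
    have := continuous_evalPairing θ; fun_prop))

/-- A pairing with `θ` is a linear statistic with coefficients bounded by `∑ |θ x|`. Its limits are
`m₁ = ∑ θ x * F x` and `m₂ = ∑ ∑ θ x * θ y * F (min x y)`, and `m₂ - m₁²/Q` is the quadratic form of
`bridgeCov F Q`. -/
theorem VarianceProfile.tendsto_charFunctional (h : VarianceProfile σ α c a F Q) (θ : ℝ →₀ ℝ) :
    Tendsto (fun N => charFunctional ((invMeasure σ α N).map (scaledFluct σ α (c N) (a N))) θ)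
      atTop (𝓝 ((Real.exp (-quadForm (bridgeCov F Q) θ / 2) : ℝ) : ℂ)) := by
  set β : (N : ℕ) → Fin (2 * N) → ℝ := fun N i =>
    ∑ x ∈ θ.support, θ x * clip i (c N + x * a N) with hβdef
  have hβ : ∀ N i, |β N i| ≤ ∑ x ∈ θ.support, |θ x| := by
    intro N i
    refine (Finset.abs_sum_le_sum_abs _ _).trans (Finset.sum_le_sum fun x _ => ?_)
    rw [abs_mul, abs_of_nonneg (clip_nonneg _ _)]
    exact mul_le_of_le_one_right (abs_nonneg _) (clip_le_one _ _)
  have h1 : Tendsto (fun N => (∑ i, sechSq (stepTilt σ α N i) * β N i) / a N) atTop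
      (𝓝 (∑ x ∈ θ.support, θ x * F x)) := by
    have := tendsto_finsetSum θ.support fun x _ => (h.tendsto_profile x).const_mul (θ x)
    refine this.congr fun N => ?_
    simp only [hβdef, Finset.mul_sum, Finset.sum_div]
    rw [Finset.sum_comm]
    exact Finset.sum_congr rfl fun i _ => Finset.sum_congr rfl fun x _ => by ring
  have h2 : Tendsto (fun N => (∑ i, sechSq (stepTilt σ α N i) * β N i ^ 2) / a N) atTop
      (𝓝 (∑ x ∈ θ.support, ∑ y ∈ θ.support, θ x * θ y * F (min x y))) := by
    have : Tendsto (fun N => ∑ x ∈ θ.support, ∑ y ∈ θ.support, θ x * θ y *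
        ((∑ i, sechSq (stepTilt σ α N i) * (clip i (c N + x * a N) * clip i (c N + y * a N))) /
          a N)) atTop (𝓝 (∑ x ∈ θ.support, ∑ y ∈ θ.support, θ x * θ y * F (min x y))) :=
      tendsto_finsetSum _ fun x _ => tendsto_finsetSum _ fun y _ =>
        (h.tendsto_mul x y).const_mul (θ x * θ y)
    refine this.congr fun N => ?_
    have e : ∀ i, sechSq (stepTilt σ α N i) * β N i ^ 2 =
        ∑ x ∈ θ.support, ∑ y ∈ θ.support, θ x * θ y * (sechSq (stepTilt σ α N i) *
          (clip i (c N + x * a N) * clip i (c N + y * a N))) := by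
      intro i
      simp only [hβdef]
      rw [sq, Finset.sum_mul_sum, Finset.mul_sum]
      refine Finset.sum_congr rfl fun x _ => ?_
      rw [Finset.mul_sum]
      exact Finset.sum_congr rfl fun y _ => by ring
    rw [Finset.sum_congr rfl fun i _ => e i]
    rw [Finset.sum_comm (s := Finset.univ), Finset.sum_div]
    refine Finset.sum_congr rfl fun x _ => ?_
    rw [Finset.sum_comm (s := Finset.univ), Finset.sum_div]
    refine Finset.sum_congr rfl fun y _ => ?_
    rw [← Finset.mul_sum, mul_div_assoc]
  have key := tendsto_integral_exp_bridge h.tendsto_scale hβ h.pos h.tendsto_total h1 h2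
  have hq : quadForm (bridgeCov F Q) θ =
      ∑ x ∈ θ.support, ∑ y ∈ θ.support, θ x * θ y * F (min x y) -
        (∑ x ∈ θ.support, θ x * F x) ^ 2 / Q := by
    rw [sq, Finset.sum_mul_sum, Finset.sum_div, ← Finset.sum_sub_distrib]
    refine Finset.sum_congr rfl fun x _ => ?_
    rw [Finset.sum_div, ← Finset.sum_sub_distrib]
    refine Finset.sum_congr rfl fun y _ => ?_
    unfold bridgeCov; ring
  rw [hq]
  refine key.congr fun N => ?_
  rw [charFunctional_scaledFluct]
  congr 1
  funext S
  rw [evalPairing_scaledFluct, Complex.ofReal_sum, Finset.sum_mul]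
  congr 1
  refine Finset.sum_congr rfl fun i _ => ?_
  rw [Complex.ofReal_mul]
  simp only [hβdef]
  ring

/-- The moment bound holds only for large `N`, whence the shift by `N₀`. Tightness of the value at
`0` follows from the convergence of its characteristic functions to a continuous function. -/
theorem VarianceProfile.exists_isTightMeasureSet (h : VarianceProfile σ α c a F Q) :
    ∃ N₀, IsTightMeasureSet (Set.range fun n =>
      (invMeasure σ α (n + N₀)).map (scaledFluct σ α (c (n + N₀)) (a (n + N₀)))) := by
  obtain ⟨N₀, hN₀⟩ := eventually_atTop.1 ((eventually_integral_centredHeight_sub_le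
    h.tendsto_scale h.pos h.tendsto_total).and (h.tendsto_scale.eventually_gt_atTop 0))
  have hC : 0 ≤ momentConst Q := by unfold momentConst; positivity
  refine ⟨N₀, isTightMeasureSet_of_moment_bound hC _ (fun n x y => ?_) ?_⟩
  · obtain ⟨h1, h2⟩ := hN₀ (n + N₀) (by omega)
    have hm : Measurable fun u : C(ℝ, ℝ) => ENNReal.ofReal ((u x - u y) ^ 4) :=
      ENNReal.measurable_ofReal.comp (Continuous.measurable
        (((continuous_eval_const x).sub (continuous_eval_const y)).pow 4))
    rw [lintegral_map hm (measurable_bridge _), ← ofReal_integral_eq_lintegral_ofReal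
      (integrable_invMeasure _ _ _) (Eventually.of_forall fun S => by positivity)]
    refine ENNReal.ofReal_le_ofReal ?_
    have h3 := h1 (c (n + N₀) + y * a (n + N₀)) (c (n + N₀) + x * a (n + N₀))
    have e : ∀ S : Bridge (n + N₀), (scaledFluct σ α (c (n + N₀)) (a (n + N₀)) S x -
        scaledFluct σ α (c (n + N₀)) (a (n + N₀)) S y) ^ 4 =
        (centredHeight σ α S (c (n + N₀) + x * a (n + N₀)) -
          centredHeight σ α S (c (n + N₀) + y * a (n + N₀))) ^ 4 / a (n + N₀) ^ 2 := by
      intro S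
      change (centredHeight σ α S (c (n + N₀) + x * a (n + N₀)) / √(a (n + N₀)) -
        centredHeight σ α S (c (n + N₀) + y * a (n + N₀)) / √(a (n + N₀))) ^ 4 = _
      rw [← sub_div, div_pow, show (4 : ℕ) = 2 * 2 by norm_num, pow_mul (√_), Real.sq_sqrt h2.le]
    simp_rw [e]
    rw [integral_div, div_le_iff₀ (by positivity)]
    refine h3.trans (le_of_eq ?_)
    ring
  · have hme : Measurable fun u : C(ℝ, ℝ) => u 0 := (continuous_eval_const 0).measurable
    have hp : ∀ n, IsProbabilityMeasure (((invMeasure σ α (n + N₀)).map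
        (scaledFluct σ α (c (n + N₀)) (a (n + N₀)))).map fun u => u 0) := fun n =>
      have := Measure.isProbabilityMeasure_map (μ := invMeasure σ α (n + N₀))
        (measurable_bridge (scaledFluct σ α (c (n + N₀)) (a (n + N₀)))).aemeasurable
      Measure.isProbabilityMeasure_map hme.aemeasurable
    refine isTightMeasureSet_of_tendsto_charFun (f := fun t : ℝ => ((Real.exp
      (-quadForm (bridgeCov F Q) (t • Finsupp.single 0 1) / 2) : ℝ) : ℂ)) ?_ fun t => ?_
    · simp_rw [quadForm_smul]
      fun_prop
    · have := (h.tendsto_charFunctional (t • Finsupp.single 0 1)).comp (tendsto_add_atTop_nat N₀)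
      refine this.congr fun n => ?_
      rw [Function.comp_apply, ← charFun_map_evalPairing]
      simp only [evalPairing_single, one_mul]

/-- The law of the rescaled fluctuations. -/
noncomputable def scaledLaw (σ α : ℝ) (c a : ℕ → ℝ) (N : ℕ) : ProbabilityMeasure C(ℝ, ℝ) :=
  ⟨(invMeasure σ α N).map (scaledFluct σ α (c N) (a N)),
    Measure.isProbabilityMeasure_map (measurable_bridge _).aemeasurable⟩

theorem VarianceProfile.exists_charFunctional_eq (h : VarianceProfile σ α c a F Q) :
    ∃ ν : ProbabilityMeasure C(ℝ, ℝ), ∀ θ, charFunctional ν θ =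
      (Real.exp (-quadForm (bridgeCov F Q) θ / 2) : ℝ) := by
  obtain ⟨N₀, hN₀⟩ := h.exists_isTightMeasureSet
  exact WeaklyAsymmetricBridge.exists_charFunctional_eq (μ := fun n => scaledLaw σ α c a (n + N₀))
    hN₀ fun θ => (h.tendsto_charFunctional θ).comp (tendsto_add_atTop_nat N₀)

/-- The invariance principle: any process with the limiting finite-dimensional laws is the limit in
distribution of the rescaled fluctuations. -/
theorem VarianceProfile.tendstoInDistribution (h : VarianceProfile σ α c a F Q) {Ω : Type*}
    [MeasurableSpace Ω] {P : Measure Ω} [IsProbabilityMeasure P] {B : Ω → C(ℝ, ℝ)}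
    (hB : Measurable B) (hchar : ∀ θ, charFunctional (P.map B) θ =
      (Real.exp (-quadForm (bridgeCov F Q) θ / 2) : ℝ)) :
    TendstoInDistribution (fun N (S : Bridge N) => scaledFluct σ α (c N) (a N) S) atTop B
      (fun N => invMeasure σ α N) P where
  forall_aemeasurable N := (measurable_bridge _).aemeasurable
  aemeasurable_limit := hB.aemeasurable
  tendsto := by
    obtain ⟨N₀, hN₀⟩ := h.exists_isTightMeasureSet
    have key := tendsto_of_tendsto_charFunctional (μ := fun n => scaledLaw σ α c a (n + N₀))
      (μ₀ := ⟨P.map B, Measure.isProbabilityMeasure_map hB.aemeasurable⟩) hN₀ fun θ => by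
        rw [ProbabilityMeasure.coe_mk, hchar]
        exact (h.tendsto_charFunctional θ).comp (tendsto_add_atTop_nat N₀)
    exact (tendsto_add_atTop_iff_nat (f := scaledLaw σ α c a) N₀).1 key

/-- The invariance principle with a time-changed Brownian bridge as the limit. -/
theorem VarianceProfile.tendstoInDistribution_bridge (h : VarianceProfile σ α c a F Q)
    (hF : Monotone F) {Ω : Type*} [MeasurableSpace Ω] {P : Measure Ω} [IsProbabilityMeasure P]
    {b : Ω → C(unitInterval, ℝ)} (hb : IsBrownianBridge b P) (τ : C(ℝ, unitInterval))
    (hτ : ∀ x, (τ x : ℝ) = F x / Q) :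
    TendstoInDistribution (fun N (S : Bridge N) => scaledFluct σ α (c N) (a N) S) atTop
      (fun ω => √Q • (b ω).comp τ) (fun N => invMeasure σ α N) P := by
  have hQ := h.pos
  have hB : Measurable fun ω => √Q • (b ω).comp τ :=
    ((ContinuousMap.continuous_precomp τ).const_smul (√Q)).measurable.comp hb.measurable
  refine h.tendstoInDistribution hB fun θ => ?_
  rw [hb.charFunctional_eq τ (√Q) hB (fun ω x => rfl)]
  have e : (fun x y => √Q ^ 2 * (min (τ x : ℝ) (τ y) - τ x * τ y)) = bridgeCov F Q := by
    funext x y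
    rw [Real.sq_sqrt hQ.le, bridgeCov, hτ, hτ, min_div_div_right hQ.le, hF.map_min]
    field_simp
  rw [e]

end Invariance

end WeaklyAsymmetricBridge

namespace WeaklyAsymmetricBridge
open scoped Topology

/-! ### Explicit variance profiles -/

lemma range_tanh : Set.range Real.tanh = Set.Ioo (-1) 1 := by
  rw [← Set.image_univ, Real.tanh_bijOn.image_eq]

lemma strictMono_tanh : StrictMono Real.tanh :=
  monotone_tanh.strictMono_of_injective Real.tanh_injective

lemma tendsto_tanh_atTop : Tendsto Real.tanh atTop (𝓝 1) :=
  tendsto_atTop_isLUB monotone_tanh (range_tanh ▸ isLUB_Ioo (by norm_num))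

lemma tendsto_tanh_atBot : Tendsto Real.tanh atBot (𝓝 (-1)) :=
  tendsto_atBot_isGLB monotone_tanh (range_tanh ▸ isGLB_Ioo (by norm_num))

lemma tanh_add_sub_tanh_sub (h δ : ℝ) :
    Real.tanh (h + δ) - Real.tanh (h - δ) =
      Real.sinh (2 * δ) / (Real.cosh h ^ 2 + Real.sinh δ ^ 2) := by
  have h1 := Real.cosh_pos (h + δ)
  have h2 := Real.cosh_pos (h - δ)
  have e1 : Real.cosh (h + δ) * Real.cosh (h - δ) = Real.cosh h ^ 2 + Real.sinh δ ^ 2 := by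
    rw [Real.cosh_add, Real.cosh_sub]
    linear_combination (Real.cosh h ^ 2) * Real.cosh_sq δ + Real.sinh δ ^ 2 * Real.cosh_sq h
  have e2 : Real.sinh (2 * δ) =
      Real.sinh (h + δ) * Real.cosh (h - δ) - Real.cosh (h + δ) * Real.sinh (h - δ) := by
    rw [← Real.sinh_sub]; congr 1; ring
  rw [← e1, e2, Real.tanh_eq_sinh_div_cosh, Real.tanh_eq_sinh_div_cosh]
  field_simp

/-- With `le_tanh_add_sub_tanh_sub`, this encloses an increment of `tanh` between two multiples of
`sech²` at the midpoint, with factors independent of `h`. For `δ` equal to half the slope, the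
intervals around consecutive tilts abut and the increments telescope. -/
lemma tanh_add_sub_tanh_sub_le (h : ℝ) {δ : ℝ} (hδ : 0 ≤ δ) :
    Real.tanh (h + δ) - Real.tanh (h - δ) ≤ Real.sinh (2 * δ) * sechSq h := by
  have h1 := Real.cosh_pos h
  have h2 : 0 ≤ Real.sinh (2 * δ) := Real.sinh_nonneg_iff.2 (by linarith)
  rw [tanh_add_sub_tanh_sub, sechSq, mul_one_div]
  gcongr
  exact le_add_of_nonneg_right (sq_nonneg _)

lemma le_tanh_add_sub_tanh_sub (h : ℝ) {δ : ℝ} (hδ : 0 ≤ δ) :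
    2 * Real.tanh δ * sechSq h ≤ Real.tanh (h + δ) - Real.tanh (h - δ) := by
  have h1 := Real.one_le_cosh h
  have h2 := Real.cosh_pos δ
  have h3 := Real.sinh_nonneg_iff.2 hδ
  rw [tanh_add_sub_tanh_sub, sechSq, mul_one_div, Real.sinh_two_mul,
    div_le_div_iff₀ (by positivity) (by positivity), Real.tanh_eq_sinh_div_cosh]
  have h4 := Real.cosh_sq δ
  field_simp
  rw [h4]
  nlinarith [mul_nonneg h3 (sq_nonneg (Real.sinh δ)), sq_nonneg (Real.sinh δ),
    one_le_pow₀ (n := 2) h1, mul_nonneg (sq_nonneg (Real.sinh δ)) (sub_nonneg.2 (one_le_pow₀ (n := 2) h1))]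

/-- The slope of the tilts: they are `slope σ α N * (N - i + 1/2)`. -/
noncomputable def slope (σ α : ℝ) (N : ℕ) : ℝ := 2 * σ / (2 * (N : ℝ)) ^ α

lemma stepTilt_eq (σ α : ℝ) (N : ℕ) (i : Fin (2 * N)) :
    stepTilt σ α N i = slope σ α N * (N - i - 1 / 2) := by
  unfold stepTilt tilt slope; push_cast; ring

/-- The variance of the tilted steps up to the position `t`. -/
noncomputable def partialVariance (σ α : ℝ) (N : ℕ) (t : ℝ) : ℝ :=
  ∑ i, sechSq (stepTilt σ α N i) * clip i t

lemma partialVariance_of_ge (σ α : ℝ) (N : ℕ) {t : ℝ} (ht : 2 * (N : ℝ) ≤ t) :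
    partialVariance σ α N t = totalVariance σ α N := by
  refine Finset.sum_congr rfl fun i _ => ?_
  have : ((i : ℕ) : ℝ) + 1 ≤ 2 * N := by exact_mod_cast i.2
  rw [clip_of_le (this.trans ht), mul_one]

lemma monotone_partialVariance (σ α : ℝ) (N : ℕ) : Monotone (partialVariance σ α N) := by
  intro s t hst
  refine Finset.sum_le_sum fun i _ => ?_
  have := sechSq_pos (stepTilt σ α N i)
  gcongr
  exact clip_mono _ hst

lemma partialVariance_le_add (σ α : ℝ) (N : ℕ) {s t : ℝ} (hst : s ≤ t) :
    partialVariance σ α N t ≤ partialVariance σ α N s + (t - s) := by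
  rw [← sub_le_iff_le_add']
  unfold partialVariance
  rw [← Finset.sum_sub_distrib]
  have h1 : ∀ i : Fin (2 * N), sechSq (stepTilt σ α N i) * clip i t -
      sechSq (stepTilt σ α N i) * clip i s ≤ clip i t - clip i s := fun i => by
    rw [← mul_sub]
    exact mul_le_of_le_one_left (sub_nonneg.2 (clip_mono _ hst)) (sechSq_le_one _)
  refine (Finset.sum_le_sum fun i _ => h1 i).trans ?_
  refine (Finset.sum_le_sum fun i _ => le_abs_self _).trans ?_
  refine (sum_abs_clip_sub_le (2 * N) s t).trans (le_of_eq ?_)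
  rw [abs_of_nonneg (sub_nonneg.2 hst)]

/-- The increment of `tanh` of the tilts up to the position `t`. -/
noncomputable def tanhDrop (σ α : ℝ) (N : ℕ) (t : ℝ) : ℝ :=
  Real.tanh (slope σ α N * N) - Real.tanh (slope σ α N * (N - t))

lemma tanhDrop_succ_sub (σ α : ℝ) (N k : ℕ) :
    tanhDrop σ α N (k + 1) - tanhDrop σ α N k =
      Real.tanh (slope σ α N * (N - k - 1 / 2) + slope σ α N / 2) -
        Real.tanh (slope σ α N * (N - k - 1 / 2) - slope σ α N / 2) := by
  unfold tanhDrop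
  rw [show slope σ α N * (N - k - 1 / 2) + slope σ α N / 2 = slope σ α N * (N - k) by ring,
    show slope σ α N * (N - k - 1 / 2) - slope σ α N / 2 = slope σ α N * (N - (k + 1)) by ring]
  ring

lemma partialVariance_natCast (σ α : ℝ) {N k : ℕ} (hk : k ≤ 2 * N) :
    partialVariance σ α N k = ∑ i ∈ Finset.range k, sechSq (slope σ α N * (N - i - 1 / 2)) := by
  unfold partialVariance
  simp_rw [stepTilt_eq]
  rw [← Finset.sum_range (fun i => sechSq (slope σ α N * (N - i - 1 / 2)) * clip i k),
    ← Finset.sum_subset (Finset.range_subset_range.2 hk)]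
  · refine Finset.sum_congr rfl fun i hi => ?_
    rw [clip_of_le (by exact_mod_cast Finset.mem_range.1 hi), mul_one]
  · intro i _ hi
    rw [clip_of_ge (by exact_mod_cast not_lt.1 fun h => hi (Finset.mem_range.2 h)), mul_zero]

lemma tanhDrop_natCast (σ α : ℝ) (N k : ℕ) :
    tanhDrop σ α N k = ∑ i ∈ Finset.range k, (tanhDrop σ α N (i + 1) - tanhDrop σ α N i) := by
  have := Finset.sum_range_sub (fun i : ℕ => tanhDrop σ α N i) k
  push_cast at this
  rw [this]
  simp [tanhDrop]

/-! ### Comparison of the variance with the increments of `tanh` -/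

section Bounds

variable {σ α : ℝ} {N : ℕ}

lemma monotone_tanhDrop (hη : 0 < slope σ α N) : Monotone (tanhDrop σ α N) := fun s t hst => by
  unfold tanhDrop
  gcongr
  apply monotone_tanh
  gcongr

/-- Exact telescoping at integer times; the `+ 1` pays for the incomplete step after `⌊t⌋₊`, whose
variance is at most `1`. -/
lemma partialVariance_le (hη : 0 < slope σ α N) {t : ℝ} (h0 : 0 ≤ t) (h1 : t ≤ 2 * N) :
    partialVariance σ α N t ≤ tanhDrop σ α N t / (2 * Real.tanh (slope σ α N / 2)) + 1 := by
  have hT : 0 < Real.tanh (slope σ α N / 2) := by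
    simpa using strictMono_tanh (half_pos hη)
  have hk : ⌊t⌋₊ ≤ 2 * N := Nat.floor_le_of_le (by exact_mod_cast h1)
  have hkt := Nat.floor_le h0
  have h2 := partialVariance_le_add σ α N hkt
  have h3 : partialVariance σ α N ⌊t⌋₊ ≤
      tanhDrop σ α N ⌊t⌋₊ / (2 * Real.tanh (slope σ α N / 2)) := by
    rw [le_div_iff₀ (by positivity), partialVariance_natCast σ α hk, tanhDrop_natCast,
      Finset.sum_mul]
    refine Finset.sum_le_sum fun i _ => ?_
    rw [tanhDrop_succ_sub, mul_comm]
    exact le_tanh_add_sub_tanh_sub _ (by linarith)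
  have h4 : tanhDrop σ α N ⌊t⌋₊ / (2 * Real.tanh (slope σ α N / 2)) ≤
      tanhDrop σ α N t / (2 * Real.tanh (slope σ α N / 2)) := by
    gcongr
    exact monotone_tanhDrop hη hkt
  linarith [Nat.lt_floor_add_one t]

/-- The incomplete step is dropped, which lowers the increment of `tanh` by at most the slope,
`tanh` being 1-Lipschitz. -/
lemma le_partialVariance (hη : 0 < slope σ α N) {t : ℝ} (h0 : 0 ≤ t) (h1 : t ≤ 2 * N) :
    (tanhDrop σ α N t - slope σ α N) / Real.sinh (slope σ α N) ≤ partialVariance σ α N t := by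
  have hT : 0 < Real.sinh (slope σ α N) := Real.sinh_pos_iff.2 hη
  have hk : ⌊t⌋₊ ≤ 2 * N := Nat.floor_le_of_le (by exact_mod_cast h1)
  have hkt := Nat.floor_le h0
  refine le_trans ?_ (monotone_partialVariance σ α N hkt)
  rw [partialVariance_natCast σ α hk, div_le_iff₀ hT]
  have h2 : tanhDrop σ α N t - slope σ α N ≤ tanhDrop σ α N ⌊t⌋₊ := by
    have h3 := le_of_abs_le (abs_tanh_sub_tanh_le (slope σ α N * (N - ⌊t⌋₊))
      (slope σ α N * (N - t)))
    have h4 : |slope σ α N * (N - ⌊t⌋₊) - slope σ α N * (N - t)| ≤ slope σ α N := by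
      rw [← mul_sub, abs_mul, abs_of_pos hη]
      refine mul_le_of_le_one_right hη.le (abs_le.2 ⟨?_, ?_⟩) <;> linarith [Nat.lt_floor_add_one t]
    unfold tanhDrop
    linarith
  refine h2.trans ?_
  rw [tanhDrop_natCast, Finset.sum_mul]
  refine Finset.sum_le_sum fun i _ => ?_
  rw [tanhDrop_succ_sub]
  refine (tanh_add_sub_tanh_sub_le _ (by linarith)).trans (le_of_eq ?_)
  rw [mul_div_cancel₀ _ two_ne_zero, mul_comm]

end Bounds

lemma tendsto_two_mul_natCast : Tendsto (fun N : ℕ => 2 * (N : ℝ)) atTop atTop :=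
  tendsto_natCast_atTop_atTop.const_mul_atTop two_pos

lemma tendsto_slope {σ α : ℝ} (hα : 0 < α) : Tendsto (slope σ α) atTop (𝓝 0) :=
  ((tendsto_rpow_atTop hα).comp tendsto_two_mul_natCast).const_div_atTop _

lemma slope_pos {σ α : ℝ} (hσ : 0 < σ) {N : ℕ} (hN : 0 < N) : 0 < slope σ α N := by
  unfold slope; positivity

lemma slope_mul_rpow (σ α : ℝ) {N : ℕ} (hN : 0 < N) :
    slope σ α N * (2 * (N : ℝ)) ^ α = 2 * σ := by
  unfold slope
  have : (0 : ℝ) < (2 * (N : ℝ)) ^ α := by positivity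
  field_simp

lemma slope_mul_natCast (σ α : ℝ) {N : ℕ} (hN : 0 < N) :
    slope σ α N * N = σ * (2 * (N : ℝ)) ^ (1 - α) := by
  unfold slope
  have : (0 : ℝ) < (2 * (N : ℝ)) ^ α := by positivity
  rw [Real.rpow_sub (by positivity), Real.rpow_one]
  field_simp

lemma tendsto_div_sinh : Tendsto (fun x : ℝ => x / Real.sinh x) (𝓝[≠] 0) (𝓝 1) := by
  have h : Tendsto (fun x : ℝ => x⁻¹ * Real.sinh x) (𝓝[≠] 0) (𝓝 1) := by
    simpa using (Real.hasDerivAt_sinh 0).tendsto_slope_zero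
  simpa [mul_comm, div_eq_mul_inv] using h.inv₀ one_ne_zero

lemma tendsto_div_tanh : Tendsto (fun x : ℝ => x / Real.tanh x) (𝓝[≠] 0) (𝓝 1) := by
  have h : Tendsto (fun x : ℝ => x⁻¹ * Real.tanh x) (𝓝[≠] 0) (𝓝 1) := by
    simpa [sechSq] using (hasDerivAt_tanh 0).tendsto_slope_zero
  simpa [mul_comm, div_eq_mul_inv] using h.inv₀ one_ne_zero

/-- The variance of the tilted steps up to `t` is asymptotic to the increment of `tanh`, divided by
the slope of the tilts. -/
theorem tendsto_partialVariance_div {σ α : ℝ} (hσ : 0 < σ) (hα : 0 < α) {a t : ℕ → ℝ} {f : ℝ}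
    (ha : Tendsto a atTop atTop) (ht : ∀ᶠ N in atTop, 0 ≤ t N ∧ t N ≤ 2 * (N : ℝ))
    (hf : Tendsto (fun N => tanhDrop σ α N (t N) / (slope σ α N * a N)) atTop (𝓝 f)) :
    Tendsto (fun N => partialVariance σ α N (t N) / a N) atTop (𝓝 f) := by
  have hpos : ∀ᶠ N in atTop, 0 < slope σ α N :=
    (eventually_gt_atTop 0).mono fun N hN => slope_pos hσ hN
  have hs : Tendsto (slope σ α) atTop (𝓝[≠] 0) :=
    tendsto_nhdsWithin_iff.2 ⟨tendsto_slope hα, hpos.mono fun N hN => hN.ne'⟩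
  have hs2 : Tendsto (fun N => slope σ α N / 2) atTop (𝓝[≠] 0) :=
    tendsto_nhdsWithin_iff.2 ⟨by simpa using (tendsto_slope (σ := σ) hα).div_const 2,
      hpos.mono fun N hN => (half_pos hN).ne'⟩
  have ha' : Tendsto (fun N => 1 / a N) atTop (𝓝 0) := ha.const_div_atTop 1
  -- Both bounds are the given quotient up to an error `1 / a N` and a factor `x / sinh x` or `x /
  -- tanh x` with `x → 0`.
  have hlow := (hf.sub ha').mul (tendsto_div_sinh.comp hs)
  have hupp := (hf.mul (tendsto_div_tanh.comp hs2)).add ha'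
  rw [sub_zero, mul_one] at hlow
  rw [add_zero, mul_one] at hupp
  refine tendsto_of_tendsto_of_tendsto_of_le_of_le' hlow hupp ?_ ?_
  · filter_upwards [hpos, ht, ha.eventually_gt_atTop 0] with N h1 h2 h3
    have hT : 0 < Real.sinh (slope σ α N) := Real.sinh_pos_iff.2 h1
    refine le_trans (le_of_eq ?_) (div_le_div_of_nonneg_right (le_partialVariance h1 h2.1 h2.2) h3.le)
    simp only [Function.comp_apply]
    field_simp
  · filter_upwards [hpos, ht, ha.eventually_gt_atTop 0] with N h1 h2 h3
    have hT : 0 < Real.tanh (slope σ α N / 2) := by simpa using strictMono_tanh (half_pos h1)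
    refine (div_le_div_of_nonneg_right (partialVariance_le h1 h2.1 h2.2) h3.le).trans (le_of_eq ?_)
    simp only [Function.comp_apply]
    field_simp

lemma partialVariance_projIcc (σ α : ℝ) (N : ℕ) (x : ℝ) :
    partialVariance σ α N (0 + x * (2 * N)) =
      partialVariance σ α N (Set.projIcc (0 : ℝ) 1 zero_le_one x * (2 * N)) := by
  refine Finset.sum_congr rfl fun i _ => ?_
  have hi : ((i : ℕ) : ℝ) + 1 ≤ 2 * N := by exact_mod_cast i.2
  have hN : (0 : ℝ) ≤ N := N.cast_nonneg
  congr 1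
  rw [zero_add]
  rcases le_total x 0 with h | h
  · rw [Set.projIcc_of_le_left _ h, clip_of_ge (i := i), clip_of_ge (i := i)]
    · simp
    · exact (mul_nonpos_of_nonpos_of_nonneg h (by positivity)).trans (Nat.cast_nonneg _)
  rcases le_total 1 x with h' | h'
  · rw [Set.projIcc_of_right_le _ h', clip_of_le (i := i), clip_of_le (i := i)]
    · simpa using hi
    · nlinarith
  · rw [Set.projIcc_of_mem _ ⟨h, h'⟩]

lemma totalVariance_eq (σ α : ℝ) (N : ℕ) :
    totalVariance σ α N =
      partialVariance σ α N (Set.projIcc (0 : ℝ) 1 zero_le_one 1 * (2 * N)) := by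
  rw [partialVariance_of_ge]; simp

lemma tendsto_slope_mul_natCast {σ α : ℝ} (hα : 1 < α) :
    Tendsto (fun N : ℕ => slope σ α N * N) atTop (𝓝 0) := by
  have := ((tendsto_rpow_neg_atTop (sub_pos.2 hα)).comp tendsto_two_mul_natCast).const_mul σ
  rw [mul_zero] at this
  refine this.congr' ?_
  filter_upwards [eventually_gt_atTop 0] with N hN
  rw [slope_mul_natCast σ α hN]
  simp

lemma tendsto_slope_mul_natCast_atTop {σ α : ℝ} (hσ : 0 < σ) (hα : α < 1) :
    Tendsto (fun N : ℕ => slope σ α N * N) atTop atTop := by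
  have := ((tendsto_rpow_atTop (sub_pos.2 hα)).comp tendsto_two_mul_natCast).const_mul_atTop hσ
  refine this.congr' ?_
  filter_upwards [eventually_gt_atTop 0] with N hN
  rw [slope_mul_natCast σ α hN, Function.comp_apply]

lemma tanhDrop_div_eq (σ α : ℝ) (N : ℕ) (x : ℝ) :
    tanhDrop σ α N (x * (2 * N)) / (slope σ α N * (2 * N)) =
      (Real.tanh (slope σ α N * N) - Real.tanh (slope σ α N * N * (1 - 2 * x))) /
        (2 * (slope σ α N * N)) := by
  rw [tanhDrop, show slope σ α N * (N - x * (2 * N)) = slope σ α N * N * (1 - 2 * x) by ring,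
    show slope σ α N * (2 * N) = 2 * (slope σ α N * N) by ring]

/-- The limiting profile of the variance for `α = 1`. -/
noncomputable def criticalProfile (σ x : ℝ) : ℝ :=
  (Real.tanh σ - Real.tanh (σ * (1 - 2 * x))) / (2 * σ)

/-- On the scale `2N` the profile depends on `N` only through `z = slope * N = σ (2N)^(1-α)`, which
tends to `0` if `α > 1` and equals `σ` if `α = 1`. The projection onto `[0,1]` reflects that the
paths are constant outside. -/
lemma varianceProfile_of_ge_one {σ α : ℝ} (hσ : 0 < σ) (hα : 0 < α) {G : ℝ → ℝ}
    (hQ : 0 < G 1) (hG : ∀ x, Tendsto (fun N : ℕ => (Real.tanh (slope σ α N * N) -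
      Real.tanh (slope σ α N * N * (1 - 2 * x))) / (2 * (slope σ α N * N))) atTop (𝓝 (G x))) :
    VarianceProfile σ α (fun _ => 0) (fun N => 2 * N)
      (fun x => G (Set.projIcc (0 : ℝ) 1 zero_le_one x)) (G 1) := by
  have key : ∀ x : unitInterval, Tendsto (fun N : ℕ => partialVariance σ α N (x * (2 * N)) /
      (2 * N)) atTop (𝓝 (G x)) := fun x => by
    refine tendsto_partialVariance_div hσ hα tendsto_two_mul_natCast
      (Eventually.of_forall fun N => ⟨?_, ?_⟩) ?_
    · have := x.2.1; positivity
    · exact mul_le_of_le_one_left (by positivity) x.2.2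
    · simp_rw [tanhDrop_div_eq]
      exact hG x
  refine ⟨tendsto_two_mul_natCast, hQ, ?_, fun x => ?_⟩
  · simp_rw [totalVariance_eq]
    simpa using key (Set.projIcc (0 : ℝ) 1 zero_le_one 1)
  · refine (key (Set.projIcc (0 : ℝ) 1 zero_le_one x)).congr fun N => ?_
    rw [← partialVariance_projIcc]
    rfl

lemma varianceProfile_of_one_lt {σ α : ℝ} (hσ : 0 < σ) (hα : 1 < α) :
    VarianceProfile σ α (fun _ => 0) (fun N => 2 * N)
      (fun x => (Set.projIcc (0 : ℝ) 1 zero_le_one x : ℝ)) 1 := by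
  refine varianceProfile_of_ge_one (G := id) hσ (by linarith) one_pos fun x => ?_
  -- As `z → 0`, the profile is half a difference quotient at `0`, with limit `x`.
  have hd : HasDerivAt (fun z => Real.tanh z - Real.tanh (z * (1 - 2 * x))) (2 * x) 0 := by
    have h1 := hasDerivAt_tanh 0
    have h2 : HasDerivAt (fun z : ℝ => Real.tanh (z * (1 - 2 * x)))
        (sechSq (0 * (1 - 2 * x)) * (1 * (1 - 2 * x))) 0 :=
      (hasDerivAt_tanh _).comp 0 ((hasDerivAt_id 0).mul_const _)
    refine (h1.sub h2).congr_deriv ?_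
    simp [sechSq]
  have hz : Tendsto (fun N : ℕ => slope σ α N * N) atTop (𝓝[≠] 0) :=
    tendsto_nhdsWithin_iff.2 ⟨tendsto_slope_mul_natCast hα,
      (eventually_gt_atTop 0).mono fun N hN => by
        have := slope_pos (α := α) hσ hN
        have : (0 : ℝ) < slope σ α N * N := by positivity
        exact this.ne'⟩
  have := (hd.tendsto_slope_zero.comp hz).div_const 2
  rw [mul_div_cancel_left₀ _ two_ne_zero] at this
  refine this.congr fun N => ?_
  simp only [Function.comp_apply, zero_add, zero_mul, Real.tanh_zero, sub_zero, smul_eq_mul]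
  rw [inv_mul_eq_div, div_div, mul_comm _ (2 : ℝ)]

lemma varianceProfile_one {σ : ℝ} (hσ : 0 < σ) :
    VarianceProfile σ 1 (fun _ => 0) (fun N => 2 * N)
      (fun x => criticalProfile σ (Set.projIcc (0 : ℝ) 1 zero_le_one x))
      (criticalProfile σ 1) := by
  refine varianceProfile_of_ge_one (G := criticalProfile σ) hσ one_pos ?_ fun x => ?_
  · unfold criticalProfile
    have := strictMono_tanh (show σ * (1 - 2 * 1) < σ by linarith)
    exact div_pos (sub_pos.2 this) (by positivity)
  · refine tendsto_const_nhds.congr' ?_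
    filter_upwards [eventually_gt_atTop 0] with N hN
    rw [slope_mul_natCast σ 1 hN]
    simp [criticalProfile]

/-- The limiting profile of the variance for `α < 1`. -/
noncomputable def windowProfile (σ x : ℝ) : ℝ := (Real.tanh (2 * σ * x) + 1) / (2 * σ)

/-- The tilts at the ends diverge, so `tanh` there tends to `±1`, while at the window point `x` the
argument of `tanh` is exactly `-2σx`. Hence the finite total mass `2 / (2σ) = 1/σ`. -/
lemma varianceProfile_of_lt_one {σ α : ℝ} (hσ : 0 < σ) (hα : 0 < α) (hα' : α < 1) :
    VarianceProfile σ α (fun N => N) (fun N => (2 * (N : ℝ)) ^ α) (windowProfile σ) (1 / σ) := by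
  have ha : Tendsto (fun N : ℕ => (2 * (N : ℝ)) ^ α) atTop atTop :=
    (tendsto_rpow_atTop hα).comp tendsto_two_mul_natCast
  have hz := tendsto_slope_mul_natCast_atTop hσ hα'
  refine ⟨ha, by positivity, ?_, fun x => ?_⟩
  · simp_rw [fun N => (partialVariance_of_ge σ α N le_rfl).symm]
    refine tendsto_partialVariance_div hσ hα ha (Eventually.of_forall fun N =>
      ⟨by positivity, le_rfl⟩) ?_
    have h1 := ((tendsto_tanh_atTop.comp hz).add (tendsto_tanh_atTop.comp hz)).div_const (2 * σ)
    rw [show (1 + 1) / (2 * σ) = 1 / σ by field_simp; norm_num] at h1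
    refine h1.congr' ?_
    filter_upwards [eventually_gt_atTop 0] with N hN
    rw [slope_mul_rpow σ α hN, tanhDrop,
      show slope σ α N * (N - 2 * N) = -(slope σ α N * N) by ring, Real.tanh_neg, sub_neg_eq_add]
    rfl
  · refine tendsto_partialVariance_div hσ hα ha ?_ ?_
    · filter_upwards [eventually_gt_atTop 0, hz.eventually_ge_atTop |2 * σ * x|] with N hN h
      have hs := slope_pos (α := α) hσ hN
      -- The window point lies in `[0, 2N]` once `slope * N ≥ |2σx|`, by `slope * (2N)^α = 2σ`.
      have h' : |x * (2 * (N : ℝ)) ^ α| ≤ N := by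
        refine le_of_mul_le_mul_left ?_ hs
        rwa [← abs_of_pos hs, ← abs_mul, abs_of_pos hs, mul_left_comm, slope_mul_rpow σ α hN,
          mul_comm]
      rw [abs_le] at h'
      constructor <;> linarith [h'.1, h'.2]
    · have h1 := ((tendsto_tanh_atTop.comp hz).add_const (Real.tanh (2 * σ * x))).div_const (2 * σ)
      rw [add_comm] at h1
      refine h1.congr' ?_
      filter_upwards [eventually_gt_atTop 0] with N hN
      rw [slope_mul_rpow σ α hN, tanhDrop, show slope σ α N * (N - (N + x * (2 * (N : ℝ)) ^ α)) =
        -(slope σ α N * (2 * (N : ℝ)) ^ α * x) by ring, slope_mul_rpow σ α hN, Real.tanh_neg,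
        sub_neg_eq_add]
      rfl

end WeaklyAsymmetricBridge

namespace WeaklyAsymmetricBridge
open scoped Topology

/-! ### The function `q_α` -/

lemma q_Icc_of_one_lt (σ : ℝ) {α : ℝ} (hα : 1 < α) {x y : ℝ} (hxy : x ≤ y) :
    q σ α (Set.Icc x y) = y - x := by
  simp [q, qDensity, hα, hxy]

lemma q_Icc_one {σ : ℝ} (hσ : 0 < σ) {x y : ℝ} (hxy : x ≤ y) :
    q σ 1 (Set.Icc x y) = criticalProfile σ y - criticalProfile σ x := by
  have hd : qDensity σ 1 = fun u => sechSq (σ * (1 - 2 * u)) := by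
    funext u; simp [qDensity, deriv_deriv_logCosh]
  have hderiv : ∀ u, HasDerivAt (criticalProfile σ) (sechSq (σ * (1 - 2 * u))) u := fun u => by
    have h1 : HasDerivAt (fun u : ℝ => Real.tanh (σ * (1 - 2 * u)))
        (sechSq (σ * (1 - 2 * u)) * (σ * (-(2 * 1)))) u :=
      (hasDerivAt_tanh _).comp u ((((hasDerivAt_id u).const_mul 2).const_sub 1).const_mul σ)
    refine ((h1.const_sub (Real.tanh σ)).div_const (2 * σ)).congr_deriv ?_
    field_simp
  rw [q, hd, integral_Icc_eq_integral_Ioc, ← intervalIntegral.integral_of_le hxy]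
  exact intervalIntegral.integral_eq_sub_of_hasDerivAt (fun u _ => hderiv u)
    ((continuous_sechSq.comp (by fun_prop)).intervalIntegrable _ _)

lemma criticalProfile_zero (σ : ℝ) : criticalProfile σ 0 = 0 := by simp [criticalProfile]

lemma continuous_criticalProfile (σ : ℝ) : Continuous (criticalProfile σ) :=
  (continuous_const.sub (continuous_tanh.comp (by fun_prop))).div_const _

lemma strictMono_criticalProfile {σ : ℝ} (hσ : 0 < σ) : StrictMono (criticalProfile σ) :=
  fun x y h => by
    have := strictMono_tanh (show σ * (1 - 2 * y) < σ * (1 - 2 * x) by gcongr)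
    unfold criticalProfile
    gcongr

section Window

variable {σ : ℝ}

lemma hasDerivAt_windowProfile (hσ : 0 < σ) (u : ℝ) :
    HasDerivAt (windowProfile σ) (sechSq (2 * σ * u)) u := by
  have h1 : HasDerivAt (fun u : ℝ => Real.tanh (2 * σ * u)) (sechSq (2 * σ * u) * (2 * σ * 1)) u :=
    (hasDerivAt_tanh _).comp u ((hasDerivAt_id u).const_mul (2 * σ))
  refine ((h1.add_const 1).div_const (2 * σ)).congr_deriv ?_
  field_simp

lemma tendsto_windowProfile_atTop (hσ : 0 < σ) :
    Tendsto (windowProfile σ) atTop (𝓝 (1 / σ)) := by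
  have h := ((tendsto_tanh_atTop.comp (tendsto_id.const_mul_atTop
    (show 0 < 2 * σ by positivity))).add_const 1).div_const (2 * σ)
  rwa [show (1 + 1) / (2 * σ) = 1 / σ by field_simp; norm_num] at h

lemma tendsto_windowProfile_atBot (hσ : 0 < σ) :
    Tendsto (windowProfile σ) atBot (𝓝 0) := by
  have h := ((tendsto_tanh_atBot.comp (tendsto_id.const_mul_atBot
    (show 0 < 2 * σ by positivity))).add_const 1).div_const (2 * σ)
  rwa [neg_add_cancel, zero_div] at h

lemma strictMono_windowProfile (hσ : 0 < σ) : StrictMono (windowProfile σ) := fun x y h => by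
  have := strictMono_tanh (show 2 * σ * x < 2 * σ * y by gcongr)
  unfold windowProfile
  gcongr

lemma continuous_windowProfile (σ : ℝ) : Continuous (windowProfile σ) :=
  ((continuous_tanh.comp (by fun_prop)).add_const _).div_const _

lemma range_windowProfile_div (hσ : 0 < σ) :
    Set.range (fun x => windowProfile σ x / (1 / σ)) = Set.Ioo 0 1 := by
  have e : ∀ x, windowProfile σ x / (1 / σ) = (Real.tanh (2 * σ * x) + 1) / 2 := fun x => by
    unfold windowProfile; field_simp
  ext y
  simp only [e, Set.mem_range]
  constructor
  · rintro ⟨x, rfl⟩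
    have h : Real.tanh (2 * σ * x) ∈ Set.Ioo (-1) 1 := range_tanh ▸ ⟨_, rfl⟩
    constructor <;> linarith [h.1, h.2]
  · rintro ⟨h0, h1⟩
    have h : 2 * y - 1 ∈ Set.Ioo (-1 : ℝ) 1 := ⟨by linarith, by linarith⟩
    rw [← range_tanh] at h
    obtain ⟨z, hz⟩ := h
    refine ⟨z / (2 * σ), ?_⟩
    rw [mul_div_cancel₀ z (by positivity), hz]
    ring

lemma qDensity_of_lt_one {α : ℝ} (hα : α < 1) :
    qDensity σ α = fun u => sechSq (2 * σ * u) := by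
  funext u; simp [qDensity, deriv_deriv_logCosh, hα.not_gt, hα.ne]

/-- On the positive half-line the density is the nonnegative derivative of a function with a finite
limit; evenness gives the other half. -/
lemma integrable_qDensity {α : ℝ} (hσ : 0 < σ) (hα : α < 1) : Integrable (qDensity σ α) := by
  rw [qDensity_of_lt_one hα, ← integrableOn_univ, ← Set.Iic_union_Ioi (a := (0 : ℝ))]
  have h1 : IntegrableOn (fun u => sechSq (2 * σ * u)) (Set.Ioi 0) :=
    integrableOn_Ioi_deriv_of_nonneg' (fun u _ => hasDerivAt_windowProfile hσ u)
      (fun u _ => (sechSq_pos _).le) (tendsto_windowProfile_atTop hσ)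
  refine IntegrableOn.union ?_ h1
  rw [← integrableOn_Ici_iff_integrableOn_Ioi, ← neg_zero] at h1
  simpa [sechSq_neg] using h1.comp_neg_Iic

lemma q_Iic {α : ℝ} (hσ : 0 < σ) (hα : α < 1) (x : ℝ) :
    q σ α (Set.Iic x) = windowProfile σ x := by
  have hi := (integrable_qDensity hσ hα).integrableOn (s := Set.Iic x)
  rw [qDensity_of_lt_one hα] at hi
  rw [q, qDensity_of_lt_one hα, integral_Iic_of_hasDerivAt_of_tendsto'
    (fun u _ => hasDerivAt_windowProfile hσ u) hi (tendsto_windowProfile_atBot hσ), sub_zero]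

lemma q_Ici {α : ℝ} (hσ : 0 < σ) (hα : α < 1) (x : ℝ) :
    q σ α (Set.Ici x) = 1 / σ - windowProfile σ x := by
  have hi := (integrable_qDensity hσ hα).integrableOn (s := Set.Ioi x)
  rw [qDensity_of_lt_one hα] at hi
  rw [q, qDensity_of_lt_one hα, integral_Ici_eq_integral_Ioi, integral_Ioi_of_hasDerivAt_of_tendsto'
    (fun u _ => hasDerivAt_windowProfile hσ u) hi (tendsto_windowProfile_atTop hσ)]

lemma q_univ {α : ℝ} (hσ : 0 < σ) (hα : α < 1) : q σ α Set.univ = 1 / σ := by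
  have hi := integrable_qDensity hσ hα
  rw [qDensity_of_lt_one hα] at hi
  rw [q, qDensity_of_lt_one hα, setIntegral_univ, integral_of_hasDerivAt_of_tendsto
    (fun u => hasDerivAt_windowProfile hσ u) hi (tendsto_windowProfile_atBot hσ)
    (tendsto_windowProfile_atTop hσ), sub_zero]

end Window

/-! ### The limits of the fluctuations -/

/-- A limit point of the discrete bridges themselves, for `σ = 1` and `α = 2`, restricted to
`[0,1]`. -/
theorem exists_isBrownianBridge :
    ∃ W : Measure C(unitInterval, ℝ), IsBrownianBridge (fun w => w) W := by
  obtain ⟨ν, hν⟩ := (varianceProfile_of_one_lt one_pos one_lt_two).exists_charFunctional_eq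
  refine ⟨_, isBrownianBridge_of_charFunctional hν (bridgeCov_comm _ _) fun s t hst => ?_⟩
  have hst' : (s : ℝ) ≤ t := hst
  simp only [bridgeCov, min_eq_left hst', Set.projIcc_val]
  ring

/-- The invariance principle on the line, with the time change extended constantly outside `[0,1]`,
is transported by the continuous restriction map. -/
lemma tendstoInDistribution_fluct {σ α Q : ℝ} {G : ℝ → ℝ}
    (h : VarianceProfile σ α (fun _ => 0) (fun N => 2 * N)
      (fun x => G (Set.projIcc (0 : ℝ) 1 zero_le_one x)) Q)
    (hG : MonotoneOn G (Set.Icc 0 1)) {Ω : Type*} [MeasurableSpace Ω] {P : Measure Ω}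
    [IsProbabilityMeasure P] {b : Ω → C(unitInterval, ℝ)} (hb : IsBrownianBridge b P)
    (τ : C(unitInterval, unitInterval)) (hτ : ∀ x, (τ x : ℝ) = G x / Q) :
    TendstoInDistribution (fun (N : ℕ) (S : Bridge N) => fluct σ α S) atTop
      (fun ω => √Q • (b ω).comp τ) (fun N => invMeasure σ α N) P := by
  have key := h.tendstoInDistribution_bridge
    (fun x y hxy => hG (Subtype.prop _) (Subtype.prop _) (Set.monotone_projIcc _ hxy)) hb
    (τ.comp ⟨Set.projIcc (0 : ℝ) 1 zero_le_one, continuous_projIcc⟩) fun x => hτ _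
  have key' := key.continuous_comp restrictUnit.continuous
  have e1 : ∀ N, (restrictUnit ∘ fun S : Bridge N => scaledFluct σ α 0 (2 * N) S) =
      fun S : Bridge N => fluct σ α S := fun N => by
    funext S
    ext x
    change centredHeight σ α S (0 + x * (2 * N)) / √(2 * N) = _
    rw [zero_add]; rfl
  have e2 : (restrictUnit ∘ fun ω => √Q • (b ω).comp
      (τ.comp ⟨Set.projIcc (0 : ℝ) 1 zero_le_one, continuous_projIcc⟩)) =
      fun ω => √Q • (b ω).comp τ := by
    funext ω
    ext x
    simp [restrictUnit_apply]
  rw [e2] at key'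
  simpa only [e1] using key'

lemma fluctWindow_eq (σ α : ℝ) {N : ℕ} (S : Bridge N) :
    fluctWindow σ α S = scaledFluct σ α N ((2 * (N : ℝ)) ^ α) S := by
  ext x
  change centredHeight σ α S _ / _ = centredHeight σ α S _ / √_
  rw [Real.sqrt_eq_rpow, ← Real.rpow_mul (by positivity), mul_one_div]

lemma IsBrownianBridge.integral_mul_of_time_change {Ω : Type*} [MeasurableSpace Ω] {P : Measure Ω}
    [IsProbabilityMeasure P] {b : Ω → C(unitInterval, ℝ)} (hb : IsBrownianBridge b P)
    {Q : ℝ} (hQ : 0 < Q) {s t : unitInterval} {f g : ℝ} (hs : (s : ℝ) = f / Q)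
    (ht : (t : ℝ) = g / Q) (hfg : f ≤ g) :
    ∫ ω, √Q * b ω s * (√Q * b ω t) ∂P = f * (Q - g) / Q := by
  simp_rw [mul_mul_mul_comm (√Q)]
  rw [integral_const_mul, hb.integral_mul, Real.mul_self_sqrt hQ.le, hs, ht,
    min_eq_left (by gcongr)]
  field_simp

end WeaklyAsymmetricBridge

/-! ### The main theorem -/

theorem theorem1 (σ α : ℝ) (hσ : 0 < σ) (hα : 0 < α) :
    -- Brownian bridges exist (as laws on the path space), so that nothing below is vacuous.
    (∃ W : Measure C(unitInterval, ℝ), IsBrownianBridge (fun w => w) W) ∧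
    -- Case `α > 1`: the limit is a Brownian bridge.
    (1 < α →
      ∀ (Ω : Type v) [MeasurableSpace Ω] (P : Measure Ω) [IsProbabilityMeasure P]
        (b : Ω → C(unitInterval, ℝ)), IsBrownianBridge b P →
        TendstoInDistribution (fun (N : ℕ) (S : Bridge N) => fluct σ α S) atTop b
            (fun N => invMeasure σ α N) P ∧
          ∀ x y : unitInterval, x ≤ y →
            ∫ ω, b ω x * b ω y ∂P =
              q σ α (Set.Icc 0 x) * q σ α (Set.Icc y 1) / q σ α (Set.Icc 0 1)) ∧
    -- Case `α = 1`: a Brownian bridge time-changed by an increasing bijection of `[0,1]`.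
    (α = 1 →
      ∃ τ : C(unitInterval, unitInterval),
        (∀ x : unitInterval, (τ x : ℝ) = q σ α (Set.Icc 0 x) / q σ α (Set.Icc 0 1)) ∧
        StrictMono τ ∧ Function.Surjective τ ∧
        ∀ (Ω : Type v) [MeasurableSpace Ω] (P : Measure Ω) [IsProbabilityMeasure P]
          (b : Ω → C(unitInterval, ℝ)), IsBrownianBridge b P →
          ∃ B : Ω → C(unitInterval, ℝ),
            (∀ ω x, B ω x = Real.sqrt (q σ α (Set.Icc 0 1)) * b ω (τ x)) ∧
            TendstoInDistribution (fun (N : ℕ) (S : Bridge N) => fluct σ α S) atTop B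
              (fun N => invMeasure σ α N) P ∧
            ∀ x y : unitInterval, x ≤ y →
              ∫ ω, B ω x * B ω y ∂P =
                q σ α (Set.Icc 0 x) * q σ α (Set.Icc y 1) / q σ α (Set.Icc 0 1)) ∧
    -- Case `α < 1`: a Brownian bridge time-changed by an increasing bijection from `ℝ` to `(0,1)`.
    (α < 1 →
      ∃ τ : C(ℝ, unitInterval),
        (∀ x : ℝ, (τ x : ℝ) = q σ α (Set.Iic x) / q σ α Set.univ) ∧
        StrictMono τ ∧ Set.range τ = Set.Ioo 0 1 ∧
        ∀ (Ω : Type v) [MeasurableSpace Ω] (P : Measure Ω) [IsProbabilityMeasure P]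
          (b : Ω → C(unitInterval, ℝ)), IsBrownianBridge b P →
          ∃ B : Ω → C(ℝ, ℝ),
            (∀ ω x, B ω x = Real.sqrt (q σ α Set.univ) * b ω (τ x)) ∧
            TendstoInDistribution (fun (N : ℕ) (S : Bridge N) => fluctWindow σ α S) atTop B
              (fun N => invMeasure σ α N) P ∧
            ∀ x y : ℝ, x ≤ y →
              ∫ ω, B ω x * B ω y ∂P =
                q σ α (Set.Iic x) * q σ α (Set.Ici y) / q σ α Set.univ) := by
  refine ⟨exists_isBrownianBridge, fun hα1 Ω _ P _ b hb => ?_, ?_, fun hα1 => ?_⟩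
  · refine ⟨?_, fun x y hxy => ?_⟩
    · have key := tendstoInDistribution_fluct (G := id) (varianceProfile_of_one_lt hσ hα1)
        (fun _ _ _ _ h => h) hb (ContinuousMap.id _) fun x => by simp
      simpa using key
    · have hxy' : (x : ℝ) ≤ y := hxy
      rw [hb.integral_mul, min_eq_left hxy', q_Icc_of_one_lt σ hα1 x.2.1,
        q_Icc_of_one_lt σ hα1 y.2.2, q_Icc_of_one_lt σ hα1 zero_le_one]
      ring
  · rintro rfl
    have hmono := strictMono_criticalProfile hσ
    have h0 := criticalProfile_zero σ
    have hQ : 0 < criticalProfile σ 1 := h0 ▸ hmono one_pos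
    have hq : ∀ x : unitInterval, q σ 1 (Set.Icc 0 x) = criticalProfile σ x := fun x => by
      rw [q_Icc_one hσ x.2.1, h0, sub_zero]
    have hq1 : q σ 1 (Set.Icc 0 1) = criticalProfile σ 1 := hq 1
    simp only [hq, hq1]
    refine ⟨⟨fun x => ⟨criticalProfile σ x / criticalProfile σ 1, ?_, ?_⟩, ?_⟩, fun x => rfl,
      fun x y hxy => ?_, ?_, fun Ω _ P _ b hb => ⟨fun ω => √(criticalProfile σ 1) • (b ω).comp _,
      fun ω x => rfl, tendstoInDistribution_fluct (varianceProfile_one hσ)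
        (hmono.monotone.monotoneOn _) hb _ fun x => rfl, fun x y hxy => ?_⟩⟩
    · exact div_nonneg (h0 ▸ hmono.monotone x.2.1) hQ.le
    · exact div_le_one_of_le₀ (hmono.monotone x.2.2) hQ.le
    · exact Continuous.subtype_mk (((continuous_criticalProfile σ).comp
        continuous_subtype_val).div_const _) _
    · exact div_lt_div_of_pos_right (hmono hxy) hQ
    · intro y
      obtain ⟨x, hx, hxy⟩ := intermediate_value_Icc zero_le_one
        (((continuous_criticalProfile σ).div_const (criticalProfile σ 1)).continuousOn)
        (show (y : ℝ) ∈ _ by rw [h0, zero_div, div_self hQ.ne']; exact y.2)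
      exact ⟨⟨x, hx⟩, Subtype.ext hxy⟩
    · rw [q_Icc_one hσ y.2.2]
      exact hb.integral_mul_of_time_change hQ rfl rfl (hmono.monotone hxy)
  · have hmono := strictMono_windowProfile hσ
    have hQ : 0 < 1 / σ := by positivity
    have hmem : ∀ x, windowProfile σ x / (1 / σ) ∈ Set.Ioo (0 : ℝ) 1 := fun x => by
      rw [← range_windowProfile_div hσ]; exact ⟨x, rfl⟩
    simp only [q_Iic hσ hα1, q_univ hσ hα1, q_Ici hσ hα1]
    refine ⟨⟨fun x => ⟨windowProfile σ x / (1 / σ), Set.Ioo_subset_Icc_self (hmem x)⟩, ?_⟩,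
      fun x => rfl, fun x y hxy => ?_, ?_, fun Ω _ P _ b hb =>
      ⟨fun ω => √(1 / σ) • (b ω).comp _, fun ω x => rfl, ?_, fun x y hxy => ?_⟩⟩
    · exact Continuous.subtype_mk ((continuous_windowProfile σ).div_const _) _
    · exact div_lt_div_of_pos_right (hmono hxy) hQ
    · ext y
      constructor
      · rintro ⟨x, rfl⟩
        exact hmem x
      · rintro hy
        have hy' : (y : ℝ) ∈ Set.Ioo (0 : ℝ) 1 := hy
        rw [← range_windowProfile_div hσ] at hy'
        obtain ⟨x, hx⟩ := hy'
        exact ⟨x, Subtype.ext hx⟩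
    · simp_rw [fluctWindow_eq]
      exact (varianceProfile_of_lt_one hσ hα hα1).tendstoInDistribution_bridge hmono.monotone hb _
        fun x => rfl
    · exact hb.integral_mul_of_time_change hQ rfl rfl (hmono.monotone hxy)
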